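/- Let $\mathfrak g$ be a finite-dimensional complex simple Lie algebra with root system $\Delta$, positive roots $\Delta^+$, simple roots and coroots $\alpha_i,\alpha_i^\vee$ $(i\in I)$, coroot lattice $Q^\vee$, Weyl group $W$ with length function $\ell$, and $\rho=\frac12\sum_{\alpha\in\Delta^+}\alpha$. For the corresponding untwisted affine Lie algebra $\mathfrak g_{\mathrm{af}}$ let $\delta$ be the null root and $W_{\mathrm{af}}=W\ltimes\{t_\xi\mid\xi\in Q^\vee\}$ the affine Weyl group; it acts on level-zero weights by $wt_\xi\mu=w\mu-\langle\xi,\mu\rangle\delta$. The real roots are $\beta=\alpha+n\delta$ with $\alpha\in\Delta$, $n\in\mathbb Z$; they form $\Delta_{\mathrm{af}}$, and $\beta$ is positive ($\beta\in\Delta_{\mathrm{af}}^+$) if $n>0$, or $n=0$ and $\alpha\in\Delta^+$; $r_\beta=r_\alpha t_{n\alpha^\vee}$ is the reflection in $\beta$, and $\beta^\vee$ its coroot. Let $\lambda$ be a level-zero dominant integral weight, that is, a level-zero weight with $\langle\alpha_i^\vee,\lambda\rangle\in\mathbb Z_{\ge0}$ for all $i\in I$. Put $J=\{i\in I\mid\langle\alpha_i^\vee,\lambda\rangle=0\}$,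 $\Delta_J=\Delta\cap\bigoplus_{j\in J}\mathbb Z\alpha_j$, and let $(W^J)_{\mathrm{af}}$ be the set of $x\in W_{\mathrm{af}}$ such that $x\beta\in\Delta_{\mathrm{af}}^+$ for all positive real roots $\beta=\alpha+n\delta$ with $\alpha\in\Delta_J$. For $x=vt_\zeta$ ($v\in W$, $\zeta\in Q^\vee$) put $\ell^{\frac\infty2}(x)=\ell(v)+2\langle\zeta,\rho\rangle$. The semi-infinite Bruhat graph has vertex set $(W^J)_{\mathrm{af}}$ and an edge $x\xrightarrow{\beta}r_\beta x$ whenever $\beta\in\Delta_{\mathrm{af}}^+$, $r_\beta x\in(W^J)_{\mathrm{af}}$ and $\ell^{\frac\infty2}(r_\beta x)=\ell^{\frac\infty2}(x)+1$. Write $x\le_{\frac\infty2}y$ if there is a directed path from $x$ to $y$. For rational $0<a\le1$, let $BG_a$ be the subgraph formed by the edges with $a\langle\beta^\vee,x\lambda\rangle\in\mathbb Z$. On $W_{\mathrm{af}}\lambda$ let $\mu\le\nu$ mean that $\nu$ is obtained from $\mu$ by finitely many (possibly zero) steps $\kappa\mapsto r_\beta\kappa$ with $\beta\in\Delta_{\mathrm{af}}^+$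 and $\langle\beta^\vee,\kappa\rangle\in\mathbb Z_{>0}$. For rational $0<a\le1$, let $LP_a$ be the directed graph on $W_{\mathrm{af}}\lambda$ with an edge $\mu\xrightarrow{\beta}\nu$ whenever $\nu$ covers $\mu$ in this order, $\nu=r_\beta\mu$ with $\beta\in\Delta_{\mathrm{af}}^+$, $\langle\beta^\vee,\mu\rangle>0$, and $a\langle\beta^\vee,\mu\rangle\in\mathbb Z$. A semi-infinite Lakshmibai–Seshadri (SiLS) path of shape $\lambda$ is a sequence $\eta=(x_1,\dots,x_s;a_0,\dots,a_s)$ with $x_u\in(W^J)_{\mathrm{af}}$, $x_1>_{\frac\infty2}\cdots>_{\frac\infty2}x_s$, rational numbers $0=a_0<a_1<\cdots<a_s=1$, and, for each $1\le u\le s-1$, a directed path from $x_{u+1}$ to $x_u$ in $BG_{a_u}$. A Littelmann LS path of shape $\lambda$ is defined in the same way with $W_{\mathrm{af}}\lambda$, $>$ and $LP_{a_u}$ in place of $(W^J)_{\mathrm{af}}$, $>_{\frac\infty2}$ and $BG_{a_u}$. Denote the sets of these paths by $\mathbb B^{\frac\infty2}(\lambda)$ and $\mathbb B(\lambda)$.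 **Proposition.** For every $\eta=(x_1,\dots,x_s;a_0,\dots,a_s)\in\mathbb B^{\frac\infty2}(\lambda)$, the sequence $\overline\eta=(x_1\lambda,\dots,x_s\lambda;a_0,\dots,a_s)$ belongs to $\mathbb B(\lambda)$, and the resulting map $\mathbb B^{\frac\infty2}(\lambda)\to\mathbb B(\lambda)$, $\eta\mapsto\overline\eta$, is surjective. -/

import Mathlib

open Module

noncomputable section

namespace SiLS

variable {ι M N : Type*} [AddCommGroup M] [Module ℂ M] [AddCommGroup N] [Module ℂ N]

/-! ### Level-zero weights -/

/-- A level-zero weight `μ + z δ`: an element of `{μ ∈ 𝔥_af^* ∣ ⟨c, μ⟩ = 0} = 𝔥^* ⊕ ℂ δ`,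
where `𝔥^* = M` is the weight space of the finite-dimensional Lie algebra `𝔤` and `δ` is the
null root. -/
@[ext]
structure LevelZeroWeight (M : Type*) where
  /-- The component in `𝔥^*`. -/
  fin : M
  /-- The coefficient of the null root `δ`. -/
  del : ℂ

variable (P : RootPairing ι ℂ M N)

/-! ### The affine Weyl group -/

/-- The coroot lattice `Q^∨`. -/
abbrev CorootLattice : Type _ := P.corootSpan ℤ

/-- The coroot lattice is stable under the finite Weyl group. -/
lemma op_smul_mem_corootSpan (w : P.weylGroup) {ξ : N} (hξ : ξ ∈ P.corootSpan ℤ) :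
    MulOpposite.op (w : P.Aut) • ξ ∈ P.corootSpan ℤ := by
  induction hξ using Submodule.span_induction with
  | mem x hx =>
    obtain ⟨i, rfl⟩ := hx
    refine Submodule.subset_span ⟨(w : P.Aut).indexEquiv.symm i, ?_⟩
    exact (congrFun (w : P.Aut).coroot_coweightMap i).symm
  | zero => simp
  | add x y _ _ hx hy => rw [smul_add]; exact add_mem hx hy
  | smul n x _ hx => rw [smul_comm]; exact Submodule.smul_mem _ n hx

/-- The element `w⁻¹ ξ` of the coroot lattice, for `w` in the finite Weyl group `W`. -/
def invAct (w : P.weylGroup) (ξ : CorootLattice P) : CorootLattice P :=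
  ⟨MulOpposite.op (w : P.Aut) • (ξ : N), op_smul_mem_corootSpan P w ξ.2⟩

/-- `⟨w⁻¹ ξ, μ⟩ = ⟨ξ, w μ⟩`. -/
lemma pairing_invAct (w : P.weylGroup) (ξ : CorootLattice P) (μ : M) :
    P.toLinearMap μ (invAct P w ξ : N) = P.toLinearMap (w • μ) (ξ : N) := by
  have h := RootPairing.Hom.weight_coweight_transpose_apply P P (ξ : N) (w : P.Aut).toHom
  exact (LinearMap.congr_fun h μ).symm

/-- The affine Weyl group `W_af = W ⋉ {t_ξ ∣ ξ ∈ Q^∨}`. The element `⟨w, ξ⟩` is `w t_ξ`. -/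
@[ext]
structure AffineWeyl where
  /-- The component in the finite Weyl group. -/
  fin : P.weylGroup
  /-- The translation part. -/
  trans : CorootLattice P

variable {P}

namespace AffineWeyl

instance : One (AffineWeyl P) := ⟨⟨1, 0⟩⟩

/-- `(v t_ξ) (w t_ζ) = v w t_{w⁻¹ ξ + ζ}`. -/
instance : Mul (AffineWeyl P) := ⟨fun x y => ⟨x.fin * y.fin, invAct P y.fin x.trans + y.trans⟩⟩

/-- `(v t_ξ)⁻¹ = v⁻¹ t_{- v ξ}`. -/
instance : Inv (AffineWeyl P) := ⟨fun x => ⟨x.fin⁻¹, -invAct P x.fin⁻¹ x.trans⟩⟩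

@[simp] lemma one_fin : (1 : AffineWeyl P).fin = 1 := rfl
@[simp] lemma one_trans : (1 : AffineWeyl P).trans = 0 := rfl
@[simp] lemma mul_fin (x y : AffineWeyl P) : (x * y).fin = x.fin * y.fin := rfl
@[simp] lemma mul_trans (x y : AffineWeyl P) :
    (x * y).trans = invAct P y.fin x.trans + y.trans := rfl
@[simp] lemma inv_fin (x : AffineWeyl P) : x⁻¹.fin = x.fin⁻¹ := rfl
@[simp] lemma inv_trans (x : AffineWeyl P) : x⁻¹.trans = -invAct P x.fin⁻¹ x.trans := rfl

lemma invAct_one (ξ : CorootLattice P) : invAct P 1 ξ = ξ :=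
  Subtype.ext (one_smul _ (ξ : N))

lemma invAct_zero (w : P.weylGroup) : invAct P w 0 = 0 :=
  Subtype.ext (smul_zero (MulOpposite.op (w : P.Aut)))

lemma invAct_add (w : P.weylGroup) (ξ ζ : CorootLattice P) :
    invAct P w (ξ + ζ) = invAct P w ξ + invAct P w ζ :=
  Subtype.ext (smul_add (MulOpposite.op (w : P.Aut)) (ξ : N) ζ)

lemma invAct_mul (v w : P.weylGroup) (ξ : CorootLattice P) :
    invAct P (v * w) ξ = invAct P w (invAct P v ξ) :=
  Subtype.ext (mul_smul (MulOpposite.op (w : P.Aut)) (MulOpposite.op (v : P.Aut)) (ξ : N))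

instance : Group (AffineWeyl P) :=
  Group.ofLeftAxioms
    (fun x y z => by
      ext1
      · simp [mul_assoc]
      · simp [invAct_add, invAct_mul, add_assoc])
    (fun x => by ext1 <;> simp [invAct_zero])
    (fun x => by
      ext1
      · simp
      · have h : invAct P x.fin (-invAct P x.fin⁻¹ x.trans) = -x.trans := by
          rw [eq_neg_iff_add_eq_zero]
          nth_rw 2 [← invAct_one x.trans]
          rw [← inv_mul_cancel x.fin, invAct_mul, ← invAct_add, neg_add_cancel, invAct_zero]
        simp [h])

/-- The action of the affine Weyl group on level-zero weights:
`w t_ξ (μ + z δ) = w μ + (z - ⟨ξ, μ⟩) δ`. -/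
instance : MulAction (AffineWeyl P) (LevelZeroWeight M) where
  smul x μ := ⟨x.fin • μ.fin, μ.del - P.toLinearMap μ.fin (x.trans : N)⟩
  one_smul μ := by
    refine LevelZeroWeight.ext (one_smul _ _) ?_
    change μ.del - P.toLinearMap μ.fin 0 = μ.del
    simp
  mul_smul x y μ := by
    refine LevelZeroWeight.ext (mul_smul _ _ _) ?_
    change μ.del - P.toLinearMap μ.fin ((invAct P y.fin x.trans : N) + (y.trans : N)) =
      μ.del - P.toLinearMap μ.fin (y.trans : N) - P.toLinearMap (y.fin • μ.fin) (x.trans : N)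
    rw [map_add, pairing_invAct]
    ring

lemma smul_fin (x : AffineWeyl P) (μ : LevelZeroWeight M) : (x • μ).fin = x.fin • μ.fin := rfl

lemma smul_del (x : AffineWeyl P) (μ : LevelZeroWeight M) :
    (x • μ).del = μ.del - P.toLinearMap μ.fin (x.trans : N) := rfl

end AffineWeyl

/-! ### Real roots -/

/-- A real root `α + n δ` of the untwisted affine Lie algebra, where `α` is a root of `𝔤`
(recorded by its index) and `n` is an integer. -/
structure RealRoot (ι : Type*) where
  /-- The index of the finite root `α`. -/
  idx : ι
  /-- The coefficient `n` of `δ`. -/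
  n : ℤ

/-- A real root, as a level-zero weight. -/
def RealRoot.toWeight (P : RootPairing ι ℂ M N) (β : RealRoot ι) : LevelZeroWeight M :=
  ⟨P.root β.idx, β.n⟩

/-- `α + n δ` is a positive real root iff `n > 0`, or `n = 0` and `α` is a positive root. -/
def RealRoot.IsPos (b : P.Base) (β : RealRoot ι) : Prop :=
  0 < β.n ∨ (β.n = 0 ∧ b.IsPos β.idx)

/-- The reflection `r_β = r_α t_{n α^∨} ∈ W_af` in the real root `β = α + n δ`. -/
def RealRoot.refl (P : RootPairing ι ℂ M N) (β : RealRoot ι) : AffineWeyl P :=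
  ⟨RootPairing.weylGroup.ofIdx P β.idx, β.n • P.corootSpanMem ℤ β.idx⟩

/-- The value `⟨β^∨, μ⟩` of the coroot of a real root `β = α + n δ` on a level-zero weight `μ`.
As `β^∨` is the sum of `α^∨` and a multiple of the canonical central element, it is the value
of `α^∨` on the component of `μ` in `𝔥^*`. -/
def RealRoot.copair (P : RootPairing ι ℂ M N) (β : RealRoot ι) (μ : LevelZeroWeight M) : ℂ :=
  P.toLinearMap μ.fin (P.coroot β.idx)

/-- `r_β` acts on level-zero weights by the usual formula `r_β μ = μ - ⟨β^∨, μ⟩ β`. -/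
lemma RealRoot.refl_smul (β : RealRoot ι) (μ : LevelZeroWeight M) :
    β.refl P • μ =
      ⟨μ.fin - β.copair P μ • (β.toWeight P).fin, μ.del - β.copair P μ * (β.toWeight P).del⟩ := by
  refine LevelZeroWeight.ext ?_ ?_
  · change P.reflection β.idx μ.fin = _
    rw [RootPairing.reflection_apply]
    rfl
  · change μ.del - P.toLinearMap μ.fin (β.n • P.coroot β.idx) = _
    simp [RealRoot.copair, RealRoot.toWeight, mul_comm]

/-- The affine Weyl group is generated by the reflections in the real roots. -/
lemma closure_range_refl :
    Subgroup.closure (Set.range fun β : RealRoot ι => β.refl P) = ⊤ := by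
  set H := Subgroup.closure (Set.range fun β : RealRoot ι => β.refl P) with hH
  have hr : ∀ β : RealRoot ι, β.refl P ∈ H := fun β => Subgroup.subset_closure ⟨β, rfl⟩
  have hfin : ∀ w : P.weylGroup, (⟨w, 0⟩ : AffineWeyl P) ∈ H := by
    rintro ⟨w, hw⟩
    induction hw using RootPairing.weylGroup.induction with
    | mem i =>
      have := hr ⟨i, 0⟩
      simpa [RealRoot.refl, RootPairing.weylGroup.ofIdx] using this
    | one => exact one_mem H
    | mul x y hx hy h1 h2 =>
      have := mul_mem h1 h2
      convert this using 1
      ext1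
      · rfl
      · simp [AffineWeyl.invAct_zero]
  have htr : ∀ ξ : N, ∀ hξ : ξ ∈ P.corootSpan ℤ, (⟨1, ⟨ξ, hξ⟩⟩ : AffineWeyl P) ∈ H := by
    intro ξ hξ
    induction hξ using Submodule.span_induction with
    | mem x hx =>
      obtain ⟨i, rfl⟩ := hx
      convert mul_mem (hr ⟨i, 0⟩) (hr ⟨i, 1⟩) using 1
      ext1
      · have h : RootPairing.weylGroup.ofIdx P i * RootPairing.weylGroup.ofIdx P i = 1 := by
          refine Subtype.ext ?_
          change RootPairing.Equiv.reflection P i * RootPairing.Equiv.reflection P i = 1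
          rw [mul_eq_one_iff_inv_eq, RootPairing.Equiv.reflection_inv P i]
        exact h.symm
      · ext1
        simp [RealRoot.refl, AffineWeyl.invAct_zero]
    | zero => exact one_mem H
    | add x y hx hy h1 h2 =>
      convert mul_mem h1 h2 using 1
      ext1
      · simp
      · simp [AffineWeyl.invAct_one]
    | smul n x hx h =>
      have hz : ∀ k : ℤ, (⟨1, k • ⟨x, hx⟩⟩ : AffineWeyl P) = ⟨1, ⟨x, hx⟩⟩ ^ k := by
        intro k
        induction k using Int.induction_on with
        | zero => ext1 <;> simp
        | succ m ih =>
          rw [zpow_add_one, ← ih]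
          ext1 <;> simp [AffineWeyl.invAct_one, add_smul]
        | pred m ih =>
          rw [zpow_sub_one, ← ih, sub_smul]
          ext1 <;> simp [AffineWeyl.invAct_one, sub_eq_add_neg]
      have := zpow_mem h n
      rw [← hz n] at this
      exact this
  rw [eq_top_iff]
  rintro ⟨w, ξ⟩ -
  convert mul_mem (hfin w) (htr ξ.1 ξ.2) using 1
  ext1
  · simp
  · simp [AffineWeyl.invAct_zero]

/-! ### Dominant weights and the parabolic data attached to them -/

/-- `λ` is a level-zero dominant integral weight: `⟨α_i^∨, λ⟩ ∈ ℤ_{≥ 0}` for all `i ∈ I`. -/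
def IsDominant (b : P.Base) (lam : LevelZeroWeight M) : Prop :=
  ∀ i ∈ b.support, ∃ m : ℕ, P.toLinearMap lam.fin (P.coroot i) = m

/-- `J_λ = {i ∈ I ∣ ⟨α_i^∨, λ⟩ = 0}`. -/
def stabSet (b : P.Base) (lam : LevelZeroWeight M) : Set ι :=
  {i | i ∈ b.support ∧ P.toLinearMap lam.fin (P.coroot i) = 0}

/-- `(Δ_J)_af = {α + n δ ∣ α ∈ Δ_J, n ∈ ℤ}`, where `Δ_J = Δ ∩ ⨁_{j ∈ J} ℤ α_j`. -/
def parabolicRoots (P : RootPairing ι ℂ M N) (J : Set ι) : Set (RealRoot ι) :=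
  {β | P.root β.idx ∈ Submodule.span ℤ (P.root '' J)}

/-- `(W^J)_af`: the `x ∈ W_af` such that `x β` is a positive real root for every positive
`β ∈ (Δ_J)_af`. -/
def petersonReps (b : P.Base) (J : Set ι) : Set (AffineWeyl P) :=
  {x | ∀ β ∈ parabolicRoots P J, β.IsPos b →
    ∃ γ : RealRoot ι, γ.IsPos b ∧ x • β.toWeight P = γ.toWeight P}

/-! ### The semi-infinite Bruhat graph -/

/-- The length of an element of the finite Weyl group: the least length of an expression as
a product of simple reflections. -/
def length (b : P.Base) (w : P.weylGroup) : ℕ :=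
  sInf {k | ∃ l : List b.support, l.length = k ∧
    (l.map fun i => RootPairing.weylGroup.ofIdx P (i : ι)).prod = w}

open scoped Classical in
/-- `ρ`, half the sum of the positive roots of `𝔤`. -/
def rho [Fintype ι] (b : P.Base) : M :=
  (1 / 2 : ℂ) • ∑ i with b.IsPos i, P.root i

/-- The semi-infinite length `ℓ(v) + 2 ⟨ζ, ρ⟩` of `x = v t_ζ`; it is an integer, viewed here as
a complex number. -/
def siLength [Fintype ι] (b : P.Base) (x : AffineWeyl P) : ℂ :=
  length b x.fin + 2 * P.toLinearMap (rho b) (x.trans : N)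

/-- Edges of the semi-infinite Bruhat graph with vertex set `(W^J)_af`: there is an edge
`x → y` with label `β` if `β` is a positive real root, `y = r_β x` and the semi-infinite length
of `y` is that of `x` plus one. -/
def SiEdge [Fintype ι] (b : P.Base) {J : Set ι} (β : RealRoot ι) (x y : petersonReps b J) : Prop :=
  β.IsPos b ∧ (y : AffineWeyl P) = β.refl P * x ∧
    siLength b (y : AffineWeyl P) = siLength b (x : AffineWeyl P) + 1

/-- The semi-infinite Bruhat order on `(W^J)_af`: there is a directed path from `x` to `y`. -/
def SiLE [Fintype ι] (b : P.Base) {J : Set ι} (x y : petersonReps b J) : Prop :=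
  Relation.ReflTransGen (fun x y => ∃ β, SiEdge b β x y) x y

/-- Edges of the subgraph with parameter `a ∈ ℚ`, for `J = J_λ`: those edges `x → y` with label
`β` such that `a ⟨β^∨, x λ⟩ ∈ ℤ`. -/
def SiEdgeAt [Fintype ι] (b : P.Base) (lam : LevelZeroWeight M) (a : ℚ)
    (x y : petersonReps b (stabSet b lam)) : Prop :=
  ∃ β, SiEdge b β x y ∧ ∃ k : ℤ, (a : ℂ) * β.copair P ((x : AffineWeyl P) • lam) = k

/-! ### The level-zero weight poset -/

/-- One step of Littelmann's order on the orbit `W_af λ`: `ν = r_β μ` for a positive real root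
`β` with `⟨β^∨, μ⟩` a positive integer. -/
def LStep (b : P.Base) {lam : LevelZeroWeight M} (β : RealRoot ι)
    (μ ν : MulAction.orbit (AffineWeyl P) lam) : Prop :=
  β.IsPos b ∧ (ν : LevelZeroWeight M) = β.refl P • (μ : LevelZeroWeight M) ∧
    ∃ m : ℤ, 0 < m ∧ β.copair P (μ : LevelZeroWeight M) = m

/-- Littelmann's order on `W_af λ`. -/
def LLE (b : P.Base) {lam : LevelZeroWeight M}
    (μ ν : MulAction.orbit (AffineWeyl P) lam) : Prop :=
  Relation.ReflTransGen (fun μ ν => ∃ β, LStep b β μ ν) μ ν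

/-- The strict version of Littelmann's order. -/
def LLT (b : P.Base) {lam : LevelZeroWeight M}
    (μ ν : MulAction.orbit (AffineWeyl P) lam) : Prop :=
  LLE b μ ν ∧ μ ≠ ν

/-- `ν` covers `μ` in Littelmann's order. -/
def LCovers (b : P.Base) {lam : LevelZeroWeight M}
    (μ ν : MulAction.orbit (AffineWeyl P) lam) : Prop :=
  LLT b μ ν ∧ ¬ ∃ κ, LLT b μ κ ∧ LLT b κ ν

/-- Edges of the Hasse graph of the level-zero weight poset with parameter `a ∈ ℚ`: `ν` covers
`μ`, and the label `β` of the edge satisfies `a ⟨β^∨, μ⟩ ∈ ℤ`. -/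
def LEdgeAt (b : P.Base) (lam : LevelZeroWeight M) (a : ℚ)
    (μ ν : MulAction.orbit (AffineWeyl P) lam) : Prop :=
  LCovers b μ ν ∧ ∃ β, LStep b β μ ν ∧
    ∃ k : ℤ, (a : ℂ) * β.copair P (μ : LevelZeroWeight M) = k

/-! ### LS paths and semi-infinite LS paths -/

/-- A pair of a sequence `x_1, …, x_s` in `X` and a sequence `a_0, a_1, …, a_s` of rational
numbers, where `s = k + 1 ≥ 1`; here `dir u = x_{u + 1}` and `brk u = a_u`. -/
structure PathData (X : Type*) where
  /-- The number `s - 1`. -/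
  k : ℕ
  /-- The sequence `x_1, …, x_s`. -/
  dir : Fin (k + 1) → X
  /-- The sequence `a_0, …, a_s`. -/
  brk : Fin (k + 2) → ℚ

/-- Apply a map to the sequence `x_1, …, x_s`, keeping `a_0, …, a_s`. -/
def PathData.map {X Y : Type*} (f : X → Y) (η : PathData X) : PathData Y :=
  ⟨η.k, fun u => f (η.dir u), η.brk⟩

/-- The condition `x_1 > ⋯ > x_s`, `0 = a_0 < ⋯ < a_s = 1`, and there is a directed path from
`x_{u+1}` to `x_u` in the graph with parameter `a_u`, for `u = 1, …, s - 1`. Here `lt x y` stands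
for `x < y`, and `edge a` is the adjacency relation of the graph with parameter `a`. -/
structure PathData.IsPath {X : Type*} (lt : X → X → Prop) (edge : ℚ → X → X → Prop)
    (η : PathData X) : Prop where
  brk_zero : η.brk 0 = 0
  brk_last : η.brk (Fin.last _) = 1
  brk_strictMono : StrictMono η.brk
  decreasing : ∀ u : Fin η.k, lt (η.dir u.succ) (η.dir u.castSucc)
  directed : ∀ u : Fin η.k,
    Relation.ReflTransGen (edge (η.brk u.succ.castSucc)) (η.dir u.succ) (η.dir u.castSucc)

/-- The set of semi-infinite LS paths of shape `λ`. -/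
def siLSPaths [Fintype ι] (b : P.Base) (lam : LevelZeroWeight M) :
    Set (PathData (petersonReps b (stabSet b lam))) :=
  {η | η.IsPath (fun x y => SiLE b x y ∧ x ≠ y) (SiEdgeAt b lam)}

/-- The set of (Littelmann's) LS paths of shape `λ`. -/
def lsPaths (b : P.Base) (lam : LevelZeroWeight M) :
    Set (PathData (MulAction.orbit (AffineWeyl P) lam)) :=
  {π | π.IsPath (LLT b) (LEdgeAt b lam)}

/-- `(x_1, …, x_s; a_0, …, a_s) ↦ (x_1 λ, …, x_s λ; a_0, …, a_s)`. -/
def bar (b : P.Base) (lam : LevelZeroWeight M) (η : PathData (petersonReps b (stabSet b lam))) :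
    PathData (MulAction.orbit (AffineWeyl P) lam) :=
  η.map fun x => ⟨x.1 • lam, MulAction.mem_orbit lam x.1⟩

end SiLS

end

set_option linter.unusedSectionVars false

namespace SiLS

/-! The map x ↦ xλ turns the edges of the semi-infinite Bruhat graph leaving x ∈ (W^J)_af into
exactly the covers of xλ in Littelmann's order, label by label. The number ⟨β^∨, xλ⟩ attached to an
edge is the same on both sides, so the integrality condition with parameter a is respected as well.
Hence images of SiLS paths are LS paths. Conversely (W^J)_af maps onto the orbit
(`exists_petersonRep`), so an LS path lifts: choose any representative of its last weight and lift
the covers one edge at a time.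

The edge-cover dictionary rests on a length function. On (W^J)_af the semi-infinite length equals
`relLength`, which only counts positive roots outside Δ_J (`siLength_eq`). On all of W_af, left
multiplication by a simple reflection r_σ changes `relLength` x by the sign of ⟨σ^∨, xλ⟩
(`relLength_refl_mul`). Any function with this property detects covers (`covers_iff`): for β > 0
with ⟨β^∨, xλ⟩ > 0, the weight r_β xλ covers xλ iff the function grows by exactly 1 from x to r_β x.

That criterion is proved by induction on β, replacing β by r_σβ for a simple σ with ⟨σ^∨, β⟩ > 0.
Positivity makes ⟨σ^∨, ·⟩ drop along the step. Both a cover and a growth by 1 then force this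
pairing to be nonzero of one sign at the two ends, so r_σ transports the whole situation. The same
induction keeps r_β x in (W^J)_af (`refl_mul_mem_of_covers`).

The argument is carried out for an abstract `ReflectionAction`. Its main concrete input is a supply
of simple affine roots, found as indecomposable positive real roots
(`IsIndecomposable.mem_simpleRoots`). -/

/-- A group `G` acting on a set `B` of roots, with reflections, and on a set `X` of weights. -/
structure ReflectionAction (G B X : Type*) [Group G] [MulAction G B] [MulAction G X] where
  /-- The reflection in a root. -/
  refl : B → G
  /-- The positive roots. -/
  pos : Set B
  /-- The simple roots. -/
  simple : Set B
  /-- The value `⟨β^∨, μ⟩` of a coroot on a weight. -/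
  pair : B → X → ℤ
  /-- The value `⟨σ^∨, β⟩` of a coroot on a root. -/
  cartan : B → B → ℤ
  /-- A height function on the roots. -/
  ht : B → ℕ
  /-- A height function on the weights. -/
  deg : X → ℝ
  refl_mul_self : ∀ β, refl β * refl β = 1
  refl_smul : ∀ g β, refl (g • β) = g * refl β * g⁻¹
  pair_smul : ∀ (g : G) β μ, pair (g • β) (g • μ) = pair β μ
  pair_refl : ∀ σ β μ, pair σ (refl β • μ) = pair σ μ - cartan σ β * pair β μ
  cartan_self : ∀ β, cartan β β = 2
  refl_smul_of_pair_eq_zero : ∀ β μ, pair β μ = 0 → refl β • μ = μ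
  simple_pos : simple ⊆ pos
  refl_simple_smul_mem : ∀ σ ∈ simple, ∀ β ∈ pos, β ≠ σ → refl σ • β ∈ pos
  -- This descent replaces word length in `G`. The sign of the Cartan integer matters: it makes
  -- ⟨σ^∨, ·⟩ drop along a step labelled β.
  exists_simple : ∀ β ∈ pos, β ∉ simple →
    ∃ σ ∈ simple, 0 < cartan σ β ∧ ht (refl σ • β) < ht β
  deg_refl_lt : ∀ β ∈ pos, ∀ μ, 0 < pair β μ → deg (refl β • μ) < deg μ

/-! ### Abstract reflection actions and Littelmann's order -/

namespace ReflectionAction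

variable {G B X : Type*} [Group G] [MulAction G B] [MulAction G X] (D : ReflectionAction G B X)

lemma pair_refl_self (σ : B) (μ : X) : D.pair σ (D.refl σ • μ) = -D.pair σ μ := by
  rw [D.pair_refl, D.cartan_self]; ring

lemma refl_smul_refl_smul (σ : B) (μ : X) : D.refl σ • D.refl σ • μ = μ := by
  rw [smul_smul, D.refl_mul_self, one_smul]

lemma inv_refl (σ : B) : (D.refl σ)⁻¹ = D.refl σ :=
  inv_eq_of_mul_eq_one_left (D.refl_mul_self σ)

lemma refl_refl_smul (σ β : B) : D.refl (D.refl σ • β) = D.refl σ * D.refl β * D.refl σ := by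
  rw [D.refl_smul, D.inv_refl]

lemma refl_refl_smul_mul (σ β : B) (x : G) :
    D.refl (D.refl σ • β) * (D.refl σ * x) = D.refl σ * (D.refl β * x) := by
  rw [D.refl_refl_smul]
  simp only [mul_assoc]
  rw [← mul_assoc (D.refl σ) (D.refl σ), D.refl_mul_self, one_mul]

/-- Induction on positive roots, by reflections in simple roots. -/
lemma pos_induction {p : B → Prop} (simple : ∀ σ ∈ D.simple, p σ)
    (step : ∀ σ ∈ D.simple, ∀ β ∈ D.pos, β ≠ σ → 0 < D.cartan σ β → p (D.refl σ • β) → p β) :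
    ∀ β ∈ D.pos, p β := by
  intro β hβ
  induction hn : D.ht β using Nat.strong_induction_on generalizing β with
  | _ n ih =>
    subst hn
    by_cases hs : β ∈ D.simple
    · exact simple β hs
    · obtain ⟨σ, hσ, hc, hlt⟩ := D.exists_simple β hβ hs
      have hne : β ≠ σ := by rintro rfl; exact hs hσ
      exact step σ hσ β hβ hne hc (ih _ hlt _ (D.refl_simple_smul_mem σ hσ β hβ hne) rfl)

/-- One step of Littelmann's order. -/
def Step (β : B) (μ ν : X) : Prop := β ∈ D.pos ∧ ν = D.refl β • μ ∧ 0 < D.pair β μ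

/-- Littelmann's order. -/
def Le (μ ν : X) : Prop := Relation.ReflTransGen (fun μ ν => ∃ β, D.Step β μ ν) μ ν

/-- The covering relation of Littelmann's order. -/
def Covers (μ ν : X) : Prop :=
  (D.Le μ ν ∧ μ ≠ ν) ∧ ¬ ∃ κ, (D.Le μ κ ∧ μ ≠ κ) ∧ (D.Le κ ν ∧ κ ≠ ν)

variable {D}

lemma Step.le {β : B} {μ ν : X} (h : D.Step β μ ν) : D.Le μ ν :=
  Relation.ReflTransGen.single ⟨β, h⟩

lemma Le.trans {μ ν κ : X} (h : D.Le μ ν) (h' : D.Le ν κ) : D.Le μ κ :=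
  Relation.ReflTransGen.trans h h'

lemma Step.deg_lt {β : B} {μ ν : X} (h : D.Step β μ ν) : D.deg ν < D.deg μ := by
  obtain ⟨hβ, rfl, hp⟩ := h
  exact D.deg_refl_lt β hβ μ hp

lemma Step.ne {β : B} {μ ν : X} (h : D.Step β μ ν) : μ ≠ ν := by
  rintro rfl
  exact lt_irrefl _ h.deg_lt

lemma Le.eq_or_deg_lt {μ ν : X} (h : D.Le μ ν) : μ = ν ∨ D.deg ν < D.deg μ := by
  induction h with
  | refl => exact Or.inl rfl
  | tail _ h ih =>
    obtain ⟨β, h⟩ := h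
    rcases ih with rfl | ih
    · exact Or.inr h.deg_lt
    · exact Or.inr (h.deg_lt.trans ih)

/-- Every step strictly lowers `deg`, so there are no cycles. -/
lemma Le.antisymm {μ ν : X} (h : D.Le μ ν) (h' : D.Le ν μ) : μ = ν := by
  rcases h.eq_or_deg_lt with h | h
  · exact h
  rcases h'.eq_or_deg_lt with h' | h'
  · exact h'.symm
  · exact absurd (h.trans h') (lt_irrefl _)

lemma Covers.eq_or_eq {μ ν κ : X} (h : D.Covers μ ν) (h₁ : D.Le μ κ) (h₂ : D.Le κ ν) :
    κ = μ ∨ κ = ν := by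
  by_contra! hc
  exact h.2 ⟨κ, ⟨h₁, hc.1.symm⟩, h₂, hc.2⟩

lemma covers_of_forall {μ ν : X} (h : D.Le μ ν) (hne : μ ≠ ν)
    (H : ∀ κ, D.Le μ κ → D.Le κ ν → κ = μ ∨ κ = ν) : D.Covers μ ν := by
  refine ⟨⟨h, hne⟩, ?_⟩
  rintro ⟨κ, ⟨h₁, h₂⟩, h₃, h₄⟩
  rcases H κ h₁ h₃ with rfl | rfl
  · exact h₂ rfl
  · exact h₄ rfl

/-! ### Folding the order along a simple reflection -/

variable (D)

lemma le_refl_smul {σ : B} (hσ : σ ∈ D.simple) {μ : X} (h : 0 ≤ D.pair σ μ) :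
    D.Le μ (D.refl σ • μ) := by
  rcases h.eq_or_lt with h | h
  · rw [D.refl_smul_of_pair_eq_zero σ μ h.symm]
    exact Relation.ReflTransGen.refl
  · exact Step.le ⟨D.simple_pos hσ, rfl, h⟩

lemma refl_smul_le {σ : B} (hσ : σ ∈ D.simple) {μ : X} (h : D.pair σ μ ≤ 0) :
    D.Le (D.refl σ • μ) μ := by
  have := D.le_refl_smul hσ (μ := D.refl σ • μ) (by rw [D.pair_refl_self]; omega)
  rwa [D.refl_smul_refl_smul] at this

/-- The smaller of `μ` and `r_σ μ`. -/
noncomputable def down (σ : B) (μ : X) : X := if 0 ≤ D.pair σ μ then μ else D.refl σ • μ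

/-- The larger of `μ` and `r_σ μ`. -/
noncomputable def up (σ : B) (μ : X) : X := if 0 ≤ D.pair σ μ then D.refl σ • μ else μ

lemma down_of_nonpos {σ : B} {μ : X} (h : D.pair σ μ ≤ 0) : D.down σ μ = D.refl σ • μ := by
  unfold down
  split_ifs with h'
  · rw [D.refl_smul_of_pair_eq_zero σ μ (le_antisymm h h')]
  · rfl

lemma up_of_nonpos {σ : B} {μ : X} (h : D.pair σ μ ≤ 0) : D.up σ μ = μ := by
  unfold up
  split_ifs with h'
  · rw [D.refl_smul_of_pair_eq_zero σ μ (le_antisymm h h')]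
  · rfl

lemma down_of_nonneg {σ : B} {μ : X} (h : 0 ≤ D.pair σ μ) : D.down σ μ = μ := if_pos h

lemma up_of_nonneg {σ : B} {μ : X} (h : 0 ≤ D.pair σ μ) : D.up σ μ = D.refl σ • μ := if_pos h

lemma down_refl_smul {σ : B} {μ : X} (h : 0 ≤ D.pair σ μ) : D.down σ (D.refl σ • μ) = μ := by
  rw [D.down_of_nonpos (by rw [D.pair_refl_self]; omega), D.refl_smul_refl_smul]

lemma up_refl_smul {σ : B} {μ : X} (h : D.pair σ μ ≤ 0) : D.up σ (D.refl σ • μ) = μ := by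
  rw [D.up_of_nonneg (by rw [D.pair_refl_self]; omega), D.refl_smul_refl_smul]

lemma eq_or_eq_of_down_eq {σ : B} {κ μ : X} (h : D.down σ κ = μ) :
    κ = μ ∨ κ = D.refl σ • μ := by
  subst h
  unfold down
  split_ifs
  · exact Or.inl rfl
  · exact Or.inr (D.refl_smul_refl_smul σ κ).symm

lemma eq_or_eq_of_up_eq {σ : B} {κ μ : X} (h : D.up σ κ = μ) :
    κ = μ ∨ κ = D.refl σ • μ := by
  subst h
  unfold up
  split_ifs
  · exact Or.inr (D.refl_smul_refl_smul σ κ).symm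
  · exact Or.inl rfl

variable {D}

lemma Step.refl_smul {σ β : B} (hσ : σ ∈ D.simple) (hne : β ≠ σ) {μ ν : X} (h : D.Step β μ ν) :
    D.Step (D.refl σ • β) (D.refl σ • μ) (D.refl σ • ν) := by
  obtain ⟨hβ, rfl, hp⟩ := h
  refine ⟨D.refl_simple_smul_mem σ hσ β hβ hne, ?_, by rwa [D.pair_smul]⟩
  rw [D.refl_refl_smul, mul_smul, D.refl_smul_refl_smul, mul_smul]

/-- A step labelled σ joins the two members of one r_σ-orbit, which fold to the same weights. For
any other label, r_σ carries the step to a step, and the mixed cases are composed with μ ≤ r_σμ or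
its reverse. -/
lemma Step.down_le_and_up_le {σ β : B} (hσ : σ ∈ D.simple) {μ ν : X} (h : D.Step β μ ν) :
    D.Le (D.down σ μ) (D.down σ ν) ∧ D.Le (D.up σ μ) (D.up σ ν) := by
  by_cases hne : β = σ
  · subst hne
    obtain ⟨hβ, rfl, hp⟩ := h
    have h' : D.pair β (D.refl β • μ) ≤ 0 := by rw [D.pair_refl_self]; omega
    rw [D.down_of_nonneg hp.le, D.up_of_nonneg hp.le, D.down_of_nonpos h', D.up_of_nonpos h',
      D.refl_smul_refl_smul]
    exact ⟨Relation.ReflTransGen.refl, Relation.ReflTransGen.refl⟩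
  · have h' := h.refl_smul hσ hne
    rcases le_total 0 (D.pair σ μ) with hμ | hμ <;> rcases le_total 0 (D.pair σ ν) with hν | hν
    · rw [D.down_of_nonneg hμ, D.up_of_nonneg hμ, D.down_of_nonneg hν, D.up_of_nonneg hν]
      exact ⟨h.le, h'.le⟩
    · rw [D.down_of_nonneg hμ, D.up_of_nonneg hμ, D.down_of_nonpos hν, D.up_of_nonpos hν]
      exact ⟨(D.le_refl_smul hσ hμ).trans h'.le, h'.le.trans (D.refl_smul_le hσ hν)⟩
    · rw [D.down_of_nonpos hμ, D.up_of_nonpos hμ, D.down_of_nonneg hν, D.up_of_nonneg hν]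
      exact ⟨(D.refl_smul_le hσ hμ).trans h.le, h.le.trans (D.le_refl_smul hσ hν)⟩
    · rw [D.down_of_nonpos hμ, D.up_of_nonpos hμ, D.down_of_nonpos hν, D.up_of_nonpos hν]
      exact ⟨h'.le, h.le⟩

lemma Le.down {σ : B} (hσ : σ ∈ D.simple) {μ ν : X} (h : D.Le μ ν) :
    D.Le (D.down σ μ) (D.down σ ν) := by
  induction h with
  | refl => exact Relation.ReflTransGen.refl
  | tail _ h ih =>
    obtain ⟨β, h⟩ := h
    exact ih.trans (h.down_le_and_up_le hσ).1

lemma Le.up {σ : B} (hσ : σ ∈ D.simple) {μ ν : X} (h : D.Le μ ν) :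
    D.Le (D.up σ μ) (D.up σ ν) := by
  induction h with
  | refl => exact Relation.ReflTransGen.refl
  | tail _ h ih =>
    obtain ⟨β, h⟩ := h
    exact ih.trans (h.down_le_and_up_le hσ).2

/-! ### Covers and simple reflections -/

/-- Both ends fold down to μ, so by monotonicity every weight in between does too, and only μ and
r_σμ fold to μ. -/
lemma covers_refl_simple {σ : B} (hσ : σ ∈ D.simple) {μ : X} (h : 0 < D.pair σ μ) :
    D.Covers μ (D.refl σ • μ) := by
  have hs : D.Step σ μ (D.refl σ • μ) := ⟨D.simple_pos hσ, rfl, h⟩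
  refine covers_of_forall hs.le hs.ne fun κ h₁ h₂ => ?_
  have h₁' := h₁.down hσ
  have h₂' := h₂.down hσ
  rw [D.down_of_nonneg h.le] at h₁'
  rw [D.down_refl_smul h.le] at h₂'
  exact D.eq_or_eq_of_down_eq (h₂'.antisymm h₁')

/-- Covers are preserved by a simple reflection which moves both weights up. -/
lemma Covers.refl_smul_of_pos {σ : B} (hσ : σ ∈ D.simple) {μ ν : X} (h : D.Covers μ ν)
    (hμ : 0 < D.pair σ μ) (hν : 0 < D.pair σ ν) : D.Covers (D.refl σ • μ) (D.refl σ • ν) := by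
  have hsμ : D.Step σ μ (D.refl σ • μ) := ⟨D.simple_pos hσ, rfl, hμ⟩
  have hsν : D.Step σ ν (D.refl σ • ν) := ⟨D.simple_pos hσ, rfl, hν⟩
  have hle := h.1.1.up hσ
  rw [D.up_of_nonneg hμ.le, D.up_of_nonneg hν.le] at hle
  refine covers_of_forall hle (fun he => h.1.2 (smul_left_cancel _ he)) fun κ h₁ h₂ => ?_
  have h₁' := h₁.down hσ
  have h₂' := h₂.down hσ
  rw [D.down_refl_smul hμ.le] at h₁'
  rw [D.down_refl_smul hν.le] at h₂'
  -- Folding down puts κ among μ, r_σμ, ν, r_σν. The value μ would lie above r_σμ, which is absurd;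
  -- if κ = ν, then μ < r_σμ ≤ ν and the cover gives r_σμ = ν.
  rcases h.eq_or_eq h₁' h₂' with he | he <;> rcases D.eq_or_eq_of_down_eq he with rfl | rfl
  · exact absurd (hsμ.le.antisymm h₁) hsμ.ne
  · exact Or.inl rfl
  · rcases h.eq_or_eq hsμ.le h₁ with he | he
    · exact absurd he.symm hsμ.ne
    · exact Or.inl he.symm
  · exact Or.inr rfl

/-- Covers are preserved by a simple reflection which moves both weights down. -/
lemma Covers.refl_smul_of_neg {σ : B} (hσ : σ ∈ D.simple) {μ ν : X} (h : D.Covers μ ν)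
    (hμ : D.pair σ μ < 0) (hν : D.pair σ ν < 0) : D.Covers (D.refl σ • μ) (D.refl σ • ν) := by
  have hsμ : D.Step σ (D.refl σ • μ) μ :=
    ⟨D.simple_pos hσ, (D.refl_smul_refl_smul _ _).symm, by rw [D.pair_refl_self]; omega⟩
  have hsν : D.Step σ (D.refl σ • ν) ν :=
    ⟨D.simple_pos hσ, (D.refl_smul_refl_smul _ _).symm, by rw [D.pair_refl_self]; omega⟩
  have hle := h.1.1.down hσ
  rw [D.down_of_nonpos hμ.le, D.down_of_nonpos hν.le] at hle
  refine covers_of_forall hle (fun he => h.1.2 (smul_left_cancel _ he)) fun κ h₁ h₂ => ?_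
  have h₁' := h₁.up hσ
  have h₂' := h₂.up hσ
  rw [D.up_refl_smul hμ.le] at h₁'
  rw [D.up_refl_smul hν.le] at h₂'
  rcases h.eq_or_eq h₁' h₂' with he | he <;> rcases D.eq_or_eq_of_up_eq he with rfl | rfl
  · rcases h.eq_or_eq h₂ hsν.le with he | he
    · exact Or.inr he.symm
    · exact absurd he hsν.ne
  · exact Or.inl rfl
  · exact absurd (hsν.le.antisymm h₂) hsν.ne
  · exact Or.inr rfl

/-- If `μ → ν = r_β μ` is a cover, `σ ≠ β` is simple and `⟨σ^∨, ν⟩ < ⟨σ^∨, μ⟩`, then both numbers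
are nonzero of the same sign. -/
lemma Step.same_sign_of_covers {σ β : B} (hσ : σ ∈ D.simple) (hne : β ≠ σ) {μ ν : X}
    (hs : D.Step β μ ν) (h : D.Covers μ ν) (hlt : D.pair σ ν < D.pair σ μ) :
    0 < D.pair σ μ ∧ 0 < D.pair σ ν ∨ D.pair σ μ < 0 ∧ D.pair σ ν < 0 := by
  by_contra! hc
  have hμ : 0 ≤ D.pair σ μ := by by_contra! h0; have := hc.2 h0; omega
  have hν : D.pair σ ν ≤ 0 := by by_contra! h0; have := hc.1 (by omega); omega
  have hs' := hs.refl_smul hσ hne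
  have h₁ := D.le_refl_smul hσ hμ
  have h₂ := D.refl_smul_le hσ hν
  -- Here ⟨σ^∨, μ⟩ ≥ 0 ≥ ⟨σ^∨, ν⟩, giving μ ≤ r_σμ < r_σν ≤ ν. The cover leaves room only for r_σμ =
  -- μ and r_σν = ν, so both pairings vanish, against the strict drop.
  rcases h.eq_or_eq h₁ (hs'.le.trans h₂) with h₃ | h₃
  · rcases h.eq_or_eq (h₁.trans hs'.le) h₂ with h₄ | h₄
    · exact hs'.ne (h₃.trans h₄.symm)
    · have h₃' := D.pair_refl_self σ μ
      have h₄' := D.pair_refl_self σ ν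
      rw [h₃] at h₃'
      rw [h₄] at h₄'
      omega
  · rw [h₃] at hs'
    exact hs'.ne (hs'.le.antisymm h₂)

/-! ### Length functions detect covers -/

section LengthFunction

variable {μ₀ : X} {f : G → ℤ}

/-- `f` is a length function relative to `μ₀`: left multiplication by a simple reflection `r_σ`
changes `f x` by the sign of `⟨σ^∨, x μ₀⟩`. -/
def IsLengthFunction (D : ReflectionAction G B X) (μ₀ : X) (f : G → ℤ) : Prop :=
  ∀ σ ∈ D.simple, ∀ x, f (D.refl σ * x) = f x + (D.pair σ (x • μ₀)).sign

/-- The difference of `f` along β is that along r_σβ, starting from r_σx, corrected by the signs of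
⟨σ^∨, ·⟩ at the two ends. That pairing does not increase along β, so the correction has the
favourable sign. -/
lemma IsLengthFunction.refl_mul (hf : D.IsLengthFunction μ₀ f) : ∀ β ∈ D.pos, ∀ x,
    (0 < D.pair β (x • μ₀) → f x < f (D.refl β * x)) ∧
      (D.pair β (x • μ₀) = 0 → f (D.refl β * x) = f x) := by
  refine D.pos_induction (fun σ hσ x => ?_) fun σ hσ β hβ hne hc ih x => ?_
  · rw [hf σ hσ x]
    refine ⟨fun h => ?_, fun h => ?_⟩
    · rw [Int.sign_eq_one_of_pos h]; omega
    · rw [h, Int.sign_zero, add_zero]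
  · have ih' := ih (D.refl σ * x)
    rw [D.refl_refl_smul_mul, hf σ hσ x, hf σ hσ, mul_smul, mul_smul, D.pair_smul,
      D.pair_refl] at ih'
    refine ⟨fun h => ?_, fun h => ?_⟩
    · have h1 := ih'.1 h
      have h2 : 0 < D.cartan σ β * D.pair β (x • μ₀) := mul_pos hc h
      have h3 : (D.pair σ (x • μ₀) - D.cartan σ β * D.pair β (x • μ₀)).sign ≤
          (D.pair σ (x • μ₀)).sign := by
        generalize D.pair σ (x • μ₀) = p at *
        generalize D.cartan σ β * D.pair β (x • μ₀) = q at *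
        rcases lt_trichotomy p 0 with hp | rfl | hp
        · rw [Int.sign_eq_neg_one_of_neg hp, Int.sign_eq_neg_one_of_neg (by omega)]
        · rw [Int.sign_eq_neg_one_of_neg (by omega)]; simp
        · rw [Int.sign_eq_one_of_pos hp]
          rcases Int.sign_trichotomy (p - q) with h | h | h <;> omega
      omega
    · have h1 := ih'.2 h
      rw [h, mul_zero, sub_zero] at h1
      omega

lemma IsLengthFunction.pair_pos (hf : D.IsLengthFunction μ₀ f) {β : B} (hβ : β ∈ D.pos) {x : G}
    (h : f x < f (D.refl β * x)) : 0 < D.pair β (x • μ₀) := by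
  rcases lt_trichotomy (D.pair β (x • μ₀)) 0 with h' | h' | h'
  · have := (hf.refl_mul β hβ (D.refl β * x)).1 (by
      rw [mul_smul, D.pair_refl_self]; omega)
    rw [← mul_assoc, D.refl_mul_self, one_mul] at this
    omega
  · have := (hf.refl_mul β hβ x).2 h'
    omega
  · exact h'

/-- The covering steps are those which change a length function by one. -/
lemma IsLengthFunction.covers_iff (hf : D.IsLengthFunction μ₀ f) : ∀ β ∈ D.pos, ∀ x,
    0 < D.pair β (x • μ₀) →
      (D.Covers (x • μ₀) (D.refl β • x • μ₀) ↔ f (D.refl β * x) = f x + 1) := by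
  refine D.pos_induction (fun σ hσ x h => ?_) fun σ hσ β hβ hne hc ih x h => ?_
  · rw [hf σ hσ x, Int.sign_eq_one_of_pos h]
    exact iff_of_true (covers_refl_simple hσ h) rfl
  · have hstep : D.Step β (x • μ₀) (D.refl β • x • μ₀) := ⟨hβ, rfl, h⟩
    have hlt : D.pair σ (D.refl β • x • μ₀) < D.pair σ (x • μ₀) := by
      rw [D.pair_refl]
      have := mul_pos hc h
      omega
    have h' : 0 < D.pair (D.refl σ • β) ((D.refl σ * x) • μ₀) := by
      rwa [mul_smul, D.pair_smul]
    have ih' := ih (D.refl σ * x) h'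
    have hinc := (hf.refl_mul _ (D.refl_simple_smul_mem σ hσ β hβ hne) _).1 h'
    rw [← mul_smul, D.refl_refl_smul_mul, mul_smul, mul_smul, mul_smul, hf σ hσ, hf σ hσ,
      mul_smul] at ih'
    rw [D.refl_refl_smul_mul, hf σ hσ, hf σ hσ, mul_smul] at hinc
    constructor
    · intro hcov
      rcases hstep.same_sign_of_covers hσ hne hcov hlt with ⟨h₁, h₂⟩ | ⟨h₁, h₂⟩
      · have := ih'.1 (hcov.refl_smul_of_pos hσ h₁ h₂)
        rw [Int.sign_eq_one_of_pos h₁, Int.sign_eq_one_of_pos h₂] at this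
        omega
      · have := ih'.1 (hcov.refl_smul_of_neg hσ h₁ h₂)
        rw [Int.sign_eq_neg_one_of_neg h₁, Int.sign_eq_neg_one_of_neg h₂] at this
        omega
    · intro hdiff
      -- Strict growth along r_σβ, together with growth exactly 1 along β, says that the sign of
      -- ⟨σ^∨, ·⟩ does not drop; since its value does drop, both values are nonzero of one sign.
      rcases lt_trichotomy (D.pair σ (D.refl β • x • μ₀)) 0 with hq | hq | hq
      · rcases lt_or_ge (D.pair σ (x • μ₀)) 0 with hp | hp
        · rw [Int.sign_eq_neg_one_of_neg hp, Int.sign_eq_neg_one_of_neg hq] at ih'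
          have := (ih'.2 (by omega)).refl_smul_of_pos hσ (by rw [D.pair_refl_self]; omega)
            (by rw [D.pair_refl_self]; omega)
          rwa [D.refl_smul_refl_smul, D.refl_smul_refl_smul] at this
        · rw [Int.sign_eq_neg_one_of_neg hq] at hinc
          have := Int.sign_nonneg_iff.2 hp
          omega
      · rw [hq, Int.sign_zero, Int.sign_eq_one_of_pos (by omega)] at hinc
        omega
      · have hp : 0 < D.pair σ (x • μ₀) := by omega
        rw [Int.sign_eq_one_of_pos hp, Int.sign_eq_one_of_pos hq] at ih'
        have := (ih'.2 (by omega)).refl_smul_of_neg hσ (by rw [D.pair_refl_self]; omega)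
          (by rw [D.pair_refl_self]; omega)
        rwa [D.refl_smul_refl_smul, D.refl_smul_refl_smul] at this

end LengthFunction

/-! ### Sets of representatives stable under simple reflections -/

section Representatives

variable {μ₀ : X} {K : Set G}

/-- If `K` is stable under the simple reflections which move `x μ₀`, then covering steps stay in
`K`. -/
lemma refl_mul_mem_of_covers
    (hK : ∀ σ ∈ D.simple, ∀ x ∈ K, D.pair σ (x • μ₀) ≠ 0 → D.refl σ * x ∈ K) :
    ∀ β ∈ D.pos, ∀ x ∈ K, 0 < D.pair β (x • μ₀) →
      D.Covers (x • μ₀) (D.refl β • x • μ₀) → D.refl β * x ∈ K := by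
  refine D.pos_induction (fun σ hσ x hx h _ => hK σ hσ x hx h.ne') fun σ hσ β hβ hne hc ih x hx
    h hcov => ?_
  have hstep : D.Step β (x • μ₀) (D.refl β • x • μ₀) := ⟨hβ, rfl, h⟩
  have hlt : D.pair σ (D.refl β • x • μ₀) < D.pair σ (x • μ₀) := by
    rw [D.pair_refl]
    have := mul_pos hc h
    omega
  -- Nonvanishing at both ends allows moving from x to r_σx inside `K`, applying the induction
  -- hypothesis there, and coming back.
  have key : D.pair σ (x • μ₀) ≠ 0 ∧ D.pair σ (D.refl β • x • μ₀) ≠ 0 ∧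
      D.Covers (D.refl σ • x • μ₀) (D.refl σ • D.refl β • x • μ₀) := by
    rcases hstep.same_sign_of_covers hσ hne hcov hlt with ⟨h₁, h₂⟩ | ⟨h₁, h₂⟩
    · exact ⟨h₁.ne', h₂.ne', hcov.refl_smul_of_pos hσ h₁ h₂⟩
    · exact ⟨h₁.ne, h₂.ne, hcov.refl_smul_of_neg hσ h₁ h₂⟩
  have h1 := ih (D.refl σ * x) (hK σ hσ x hx key.1) (by rwa [mul_smul, D.pair_smul]) (by
    rw [← mul_smul (D.refl (D.refl σ • β)), D.refl_refl_smul_mul, mul_smul, mul_smul, mul_smul]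
    exact key.2.2)
  rw [D.refl_refl_smul_mul] at h1
  have h2 := hK σ hσ _ h1 (by
    rw [mul_smul, mul_smul, D.pair_refl_self]
    exact neg_ne_zero.2 key.2.1)
  rwa [← mul_assoc, D.refl_mul_self, one_mul] at h2

/-- If moreover the group is generated by the reflections, `K μ₀` is the whole orbit. -/
lemma exists_mem_smul_eq
    (hK : ∀ σ ∈ D.simple, ∀ x ∈ K, D.pair σ (x • μ₀) ≠ 0 → D.refl σ * x ∈ K) (h1 : (1 : G) ∈ K)
    (hgen : ∀ g : G, g ∈ Subgroup.closure {g | ∃ β ∈ D.pos, g = D.refl β}) (g : G) :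
    ∃ x ∈ K, x • μ₀ = g • μ₀ := by
  have hrefl : ∀ β ∈ D.pos, ∀ μ, (∃ x ∈ K, x • μ₀ = μ) → ∃ x ∈ K, x • μ₀ = D.refl β • μ := by
    refine D.pos_induction (fun σ hσ => ?_) fun σ hσ β hβ hne hc ih => ?_
    all_goals
      have hs : ∀ μ, (∃ x ∈ K, x • μ₀ = μ) → ∃ x ∈ K, x • μ₀ = D.refl σ • μ := by
        rintro _ ⟨x, hx, rfl⟩
        by_cases h0 : D.pair σ (x • μ₀) = 0
        · exact ⟨x, hx, (D.refl_smul_of_pair_eq_zero _ _ h0).symm⟩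
        · exact ⟨_, hK σ hσ x hx h0, mul_smul _ _ _⟩
    · exact hs
    · intro μ hμ
      have := hs _ (ih _ (hs _ hμ))
      rwa [D.refl_refl_smul, mul_smul, mul_smul, D.refl_smul_refl_smul, D.refl_smul_refl_smul]
        at this
  have key : ∀ μ, (∃ x ∈ K, x • μ₀ = μ) → ∃ x ∈ K, x • μ₀ = g • μ := by
    induction hgen g using Subgroup.closure_induction'' with
    | one => simp
    | mem g hg =>
      obtain ⟨β, hβ, rfl⟩ := hg
      exact hrefl β hβ
    | inv_mem g hg =>
      obtain ⟨β, hβ, rfl⟩ := hg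
      rw [D.inv_refl]
      exact hrefl β hβ
    | mul g g' _ _ hg hg' =>
      intro μ hμ
      rw [mul_smul]
      exact hg _ (hg' _ hμ)
  exact key μ₀ ⟨1, h1, one_smul _ _⟩

end Representatives

end ReflectionAction

end SiLS

noncomputable section

namespace SiLS

/-! ### The affine Weyl group and the real roots -/

section RealRoots

variable {ι M N : Type*} [AddCommGroup M] [Module ℂ M] [AddCommGroup N] [Module ℂ N]
  {P : RootPairing ι ℂ M N}

lemma root_weyl_smul (w : P.weylGroup) (i : ι) : P.root (w • i) = w • P.root i :=
  (P.weylGroup_apply_root w i).symm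

lemma weyl_smul_smul (w : P.weylGroup) (c : ℂ) (m : M) : w • c • m = c • w • m :=
  smul_comm (w : P.Aut) c m

lemma weyl_smul_sub (w : P.weylGroup) (m m' : M) : w • (m - m') = w • m - w • m' :=
  smul_sub (w : P.Aut) m m'

lemma op_smul_coroot (w : P.weylGroup) (i : ι) :
    MulOpposite.op (w : P.Aut) • P.coroot (w • i) = P.coroot i := by
  have h := congrFun (w : P.Aut).coroot_coweightMap (w • i)
  refine h.trans ?_
  change P.coroot ((w : P.Aut).indexEquiv.symm ((w : P.Aut).indexEquiv i)) = _
  rw [Equiv.symm_apply_apply]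

lemma pairing_coroot_weyl_smul (w : P.weylGroup) (μ : M) (i : ι) :
    P.toLinearMap (w • μ) (P.coroot (w • i)) = P.toLinearMap μ (P.coroot i) := by
  have h := RootPairing.Hom.weight_coweight_transpose_apply P P (P.coroot (w • i)) (w : P.Aut).toHom
  have h' := LinearMap.congr_fun h μ
  rw [← op_smul_coroot w i]
  exact h'

/-- The action is faithful: the finite part is seen on 𝔥^*, and the translation in the δ-coefficient
through the perfect pairing. Identities in W_af can thus be checked on weights. -/
lemma AffineWeyl.ext_smul {x y : AffineWeyl P} (h : ∀ μ : LevelZeroWeight M, x • μ = y • μ) :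
    x = y := by
  ext1
  · refine Subtype.ext (RootPairing.Equiv.weightHom_injective P (LinearEquiv.ext fun m => ?_))
    exact congrArg LevelZeroWeight.fin (h ⟨m, 0⟩)
  · refine Subtype.ext (P.flip.toPerfPair.injective (LinearMap.ext fun m => ?_))
    have := congrArg LevelZeroWeight.del (h ⟨m, 0⟩)
    simpa [AffineWeyl.smul_del] using this

lemma RealRoot.toWeight_injective : Function.Injective (RealRoot.toWeight P) := by
  rintro ⟨i, n⟩ ⟨j, m⟩ h
  have h1 := P.root.injective (congrArg LevelZeroWeight.fin h)
  have h2 : (n : ℂ) = m := congrArg LevelZeroWeight.del h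
  rw [Int.cast_inj] at h2
  simp_all

variable [P.IsCrystallographic]

lemma coe_pairingIn (i j : ι) : ((P.pairingIn ℤ i j : ℤ) : ℂ) = P.pairing i j :=
  P.algebraMap_pairingIn ℤ i j

lemma exists_latticePairing (ξ : CorootLattice P) (i : ι) :
    ∃ z : ℤ, P.toLinearMap (P.root i) (ξ : N) = z := by
  obtain ⟨ξ, hξ⟩ := ξ
  induction hξ using Submodule.span_induction with
  | mem x hx =>
    obtain ⟨j, rfl⟩ := hx
    exact ⟨P.pairingIn ℤ i j, (coe_pairingIn i j).symm⟩
  | zero => exact ⟨0, by simp⟩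
  | add x y _ _ hx hy =>
    obtain ⟨a, ha⟩ := hx
    obtain ⟨c, hc⟩ := hy
    exact ⟨a + c, by simp_all⟩
  | smul n x _ hx =>
    obtain ⟨a, ha⟩ := hx
    exact ⟨n * a, by simp_all⟩

/-- The integer `⟨ξ, α_i⟩` for `ξ` in the coroot lattice and a root `α_i`. -/
def latticePairing (ξ : CorootLattice P) (i : ι) : ℤ := (exists_latticePairing ξ i).choose

lemma coe_latticePairing (ξ : CorootLattice P) (i : ι) :
    (latticePairing ξ i : ℂ) = P.toLinearMap (P.root i) (ξ : N) :=
  (exists_latticePairing ξ i).choose_spec.symm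

instance : SMul (AffineWeyl P) (RealRoot ι) :=
  ⟨fun x β => ⟨x.fin • β.idx, β.n - latticePairing x.trans β.idx⟩⟩

lemma RealRoot.smul_idx (x : AffineWeyl P) (β : RealRoot ι) : (x • β).idx = x.fin • β.idx := rfl

lemma RealRoot.smul_n (x : AffineWeyl P) (β : RealRoot ι) :
    (x • β).n = β.n - latticePairing x.trans β.idx := rfl

lemma RealRoot.toWeight_smul (x : AffineWeyl P) (β : RealRoot ι) :
    (x • β).toWeight P = x • β.toWeight P := by
  refine LevelZeroWeight.ext (root_weyl_smul _ _) ?_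
  rw [AffineWeyl.smul_del]
  change ((β.n - latticePairing x.trans β.idx : ℤ) : ℂ) = _
  rw [Int.cast_sub, coe_latticePairing]
  rfl

instance : MulAction (AffineWeyl P) (RealRoot ι) where
  one_smul β := RealRoot.toWeight_injective (P := P) (by
    rw [RealRoot.toWeight_smul, one_smul])
  mul_smul x y β := RealRoot.toWeight_injective (P := P) (by
    rw [RealRoot.toWeight_smul, RealRoot.toWeight_smul, RealRoot.toWeight_smul, mul_smul])

lemma RealRoot.copair_smul (x : AffineWeyl P) (β : RealRoot ι) (μ : LevelZeroWeight M) :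
    (x • β).copair P (x • μ) = β.copair P μ :=
  pairing_coroot_weyl_smul _ _ _

lemma RealRoot.refl_smul_root (x : AffineWeyl P) (β : RealRoot ι) :
    (x • β).refl P = x * β.refl P * x⁻¹ := by
  rw [eq_mul_inv_iff_mul_eq]
  refine AffineWeyl.ext_smul fun μ => ?_
  rw [mul_smul, mul_smul, RealRoot.refl_smul, RealRoot.refl_smul, RealRoot.copair_smul,
    RealRoot.toWeight_smul]
  refine LevelZeroWeight.ext ?_ ?_
  · simp only [AffineWeyl.smul_fin, weyl_smul_sub, weyl_smul_smul]
  · simp only [AffineWeyl.smul_del, map_sub, map_smul, LinearMap.sub_apply, LinearMap.smul_apply,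
      smul_eq_mul]
    ring

lemma RealRoot.copair_toWeight (β γ : RealRoot ι) :
    β.copair P (γ.toWeight P) = P.pairingIn ℤ γ.idx β.idx := (coe_pairingIn _ _).symm

lemma RealRoot.copair_refl_smul (σ β : RealRoot ι) (μ : LevelZeroWeight M) :
    σ.copair P (β.refl P • μ) =
      σ.copair P μ - P.pairingIn ℤ β.idx σ.idx * β.copair P μ := by
  rw [RealRoot.refl_smul, coe_pairingIn]
  simp [RealRoot.copair, RealRoot.toWeight, mul_comm]

lemma RealRoot.refl_mul_self (β : RealRoot ι) : β.refl P * β.refl P = 1 := by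
  refine AffineWeyl.ext_smul fun μ => ?_
  have h := RealRoot.copair_refl_smul (P := P) β β μ
  rw [mul_smul, one_smul, RealRoot.refl_smul β (β.refl P • μ), h, RealRoot.refl_smul]
  refine LevelZeroWeight.ext ?_ ?_
  · simp; module
  · simp; ring

lemma RealRoot.refl_smul_idx (σ β : RealRoot ι) :
    (σ.refl P • β).idx = P.reflectionPerm σ.idx β.idx := rfl

lemma RealRoot.refl_smul_n (σ β : RealRoot ι) :
    (σ.refl P • β).n = β.n - P.pairingIn ℤ β.idx σ.idx * σ.n := by
  have := congrArg LevelZeroWeight.del (RealRoot.toWeight_smul (σ.refl P) β)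
  rw [RealRoot.refl_smul, RealRoot.copair_toWeight] at this
  refine Int.cast_injective (α := ℂ) ?_
  rw [Int.cast_sub, Int.cast_mul]
  exact this

lemma RealRoot.refl_smul_self (β : RealRoot ι) :
    β.refl P • β = ⟨P.reflectionPerm β.idx β.idx, -β.n⟩ := by
  refine RealRoot.toWeight_injective (P := P) ?_
  rw [RealRoot.toWeight_smul, RealRoot.refl_smul, RealRoot.copair_toWeight]
  refine LevelZeroWeight.ext ?_ ?_
  · simp [RealRoot.toWeight]; module
  · simp [RealRoot.toWeight]; ring

lemma root_reflectionPerm_self (i : ι) : P.root (P.reflectionPerm i i) = -P.root i := by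
  simp

end RealRoots

/-! ### Positive and simple real roots -/

section Positive

variable {ι M N : Type*} [Fintype ι] [AddCommGroup M] [Module ℂ M] [AddCommGroup N] [Module ℂ N]
  {P : RootPairing ι ℂ M N} [P.IsCrystallographic] [P.IsReduced] (b : P.Base)

lemma height_reflectionPerm_self (i : ι) : b.height (P.reflectionPerm i i) = -b.height i :=
  b.height_reflectionPerm_self i

lemma isPos_reflectionPerm_self_iff (i : ι) : b.IsPos (P.reflectionPerm i i) ↔ ¬ b.IsPos i :=
  RootPairing.Base.IsPos.neg_iff_not b i

/-- The affine height of a real root. -/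
def affHeight (β : RealRoot ι) : ℤ := b.height β.idx + β.n * (1 + ∑ i, |b.height i|)

/-- The weight given to δ exceeds every finite height in absolute value, so the δ-coefficient
decides the sign unless it is zero. Positivity thereby becomes positivity of an additive function.
-/
lemma affHeight_pos_iff (β : RealRoot ι) : 0 < affHeight b β ↔ β.IsPos b := by
  unfold affHeight RealRoot.IsPos
  rw [RootPairing.Base.isPos_iff]
  have h : |b.height β.idx| ≤ ∑ i, |b.height i| :=
    Finset.single_le_sum (f := fun i => |b.height i|) (fun _ _ => abs_nonneg _) (Finset.mem_univ _)
  generalize (∑ i, |b.height i|) = H at *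
  have h1 := (abs_le.1 h)
  rcases lt_trichotomy β.n 0 with hn | hn | hn
  · have : β.n * (1 + H) ≤ (-1) * (1 + H) := mul_le_mul_of_nonneg_right (by omega) (by omega)
    omega
  · simp [hn]
  · have : 1 * (1 + H) ≤ β.n * (1 + H) := mul_le_mul_of_nonneg_right (by omega) (by omega)
    omega

lemma affHeight_ne_zero (β : RealRoot ι) : affHeight b β ≠ 0 := by
  intro h0
  have h1 := (affHeight_pos_iff b β).not
  have h2 := (affHeight_pos_iff b (⟨P.reflectionPerm β.idx β.idx, -β.n⟩ : RealRoot ι)).not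
  have h3 : affHeight b (⟨P.reflectionPerm β.idx β.idx, -β.n⟩ : RealRoot ι) = - affHeight b β := by
    simp only [affHeight, height_reflectionPerm_self]; ring
  rw [h0] at h1 h3
  rw [h3] at h2
  simp only [RealRoot.IsPos, isPos_reflectionPerm_self_iff, neg_zero, lt_irrefl, not_false_iff,
    true_iff] at h1 h2
  rcases lt_trichotomy β.n 0 with hn | hn | hn
  · exact h2 (Or.inl (by omega))
  · by_cases hp : b.IsPos β.idx
    · exact h1 (Or.inr ⟨hn, hp⟩)
    · exact h2 (Or.inr ⟨by omega, hp⟩)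
  · exact h1 (Or.inl hn)

/-- The negative of a real root. -/
def negRoot (P : RootPairing ι ℂ M N) (β : RealRoot ι) : RealRoot ι :=
  ⟨P.reflectionPerm β.idx β.idx, -β.n⟩

lemma affHeight_negRoot (β : RealRoot ι) : affHeight b (negRoot P β) = -affHeight b β := by
  simp only [affHeight, negRoot, height_reflectionPerm_self]; ring

lemma affHeight_refl_smul (σ β : RealRoot ι) :
    affHeight b (σ.refl P • β) =
      affHeight b β - P.pairingIn ℤ β.idx σ.idx * affHeight b σ := by
  have h : P.root (σ.refl P • β).idx =
      P.root β.idx + (-P.pairingIn ℤ β.idx σ.idx) • P.root σ.idx := by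
    rw [RealRoot.refl_smul_idx, RootPairing.root_reflectionPerm,
      RootPairing.reflection_apply_root' ℤ, sub_eq_add_neg, neg_smul]
  unfold affHeight
  rw [b.height_add_zsmul h, RealRoot.refl_smul_n, smul_eq_mul]
  ring

lemma isPos_negRoot_iff (β : RealRoot ι) : (negRoot P β).IsPos b ↔ ¬ β.IsPos b := by
  rw [← affHeight_pos_iff, ← affHeight_pos_iff, affHeight_negRoot]
  have := affHeight_ne_zero b β
  omega

/-- `γ = β₁ + β₂`. -/
def IsSum (P : RootPairing ι ℂ M N) (γ β₁ β₂ : RealRoot ι) : Prop :=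
  P.root γ.idx = P.root β₁.idx + P.root β₂.idx ∧ γ.n = β₁.n + β₂.n

variable {b} in
lemma IsSum.affHeight {γ β₁ β₂ : RealRoot ι} (h : IsSum P γ β₁ β₂) :
    affHeight b γ = affHeight b β₁ + affHeight b β₂ := by
  unfold SiLS.affHeight
  rw [b.height_add h.1, h.2]
  ring

/-- `γ = 2 β₁ + β₂`. -/
def IsTwoSum (P : RootPairing ι ℂ M N) (γ β₁ β₂ : RealRoot ι) : Prop :=
  P.root γ.idx = P.root β₂.idx + (2 : ℤ) • P.root β₁.idx ∧ γ.n = 2 * β₁.n + β₂.n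

variable {b} in
lemma IsTwoSum.affHeight {γ β₁ β₂ : RealRoot ι} (h : IsTwoSum P γ β₁ β₂) :
    affHeight b γ = 2 * affHeight b β₁ + affHeight b β₂ := by
  unfold SiLS.affHeight
  rw [b.height_add_zsmul h.1, h.2, smul_eq_mul]
  ring

/-- A positive real root is indecomposable if it is neither of the form `β₁ + β₂` nor of the form
`2 β₁ + β₂` for positive real roots `β₁` and `β₂`. -/
def IsIndecomposable (β : RealRoot ι) : Prop :=
  β.IsPos b ∧ ∀ β₁ β₂ : RealRoot ι, β₁.IsPos b → β₂.IsPos b →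
    ¬ IsSum P β β₁ β₂ ∧ ¬ IsTwoSum P β β₁ β₂

/-- The simple real roots: the positive real roots `σ` such that `r_σ` permutes the other positive
real roots. -/
def simpleRoots : Set (RealRoot ι) :=
  {σ | σ.IsPos b ∧ ∀ β : RealRoot ι, β.IsPos b → β ≠ σ → (σ.refl P • β).IsPos b}

open scoped Classical in
/-- The least `n` such that `α_i + n δ` is positive. -/
def posShift (i : ι) : ℤ := if b.IsPos i then 0 else 1

lemma isPos_mk_iff (i : ι) (n : ℤ) : (⟨i, n⟩ : RealRoot ι).IsPos b ↔ posShift b i ≤ n := by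
  unfold RealRoot.IsPos posShift
  split_ifs with h <;> simp [h] <;> omega

lemma isPos_iff_posShift_le (β : RealRoot ι) : β.IsPos b ↔ posShift b β.idx ≤ β.n :=
  isPos_mk_iff b β.idx β.n

lemma posShift_reflectionPerm_self (i : ι) :
    posShift b (P.reflectionPerm i i) = 1 - posShift b i := by
  unfold posShift
  rw [isPos_reflectionPerm_self_iff]
  split_ifs <;> simp_all

lemma posShift_le_one (i : ι) : posShift b i ≤ 1 := by
  unfold posShift; split_ifs <;> simp

variable {b} in
lemma IsIndecomposable.n_eq {σ : RealRoot ι} (h : IsIndecomposable b σ) :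
    σ.n = posShift b σ.idx := by
  by_contra hne
  have h1 := (isPos_iff_posShift_le b σ).1 h.1
  -- With s the least shift, α + nδ = 2(α + sδ) + (-α + (n - 2s)δ), and the last root is positive as
  -- soon as n > s. Such a σ need not be a sum of two real roots, whence the forms 2β₁ + β₂.
  refine (h.2 ⟨σ.idx, posShift b σ.idx⟩
    ⟨P.reflectionPerm σ.idx σ.idx, σ.n - 2 * posShift b σ.idx⟩ ?_ ?_).2 ⟨?_, ?_⟩
  · rw [isPos_mk_iff]
  · rw [isPos_mk_iff, posShift_reflectionPerm_self]
    omega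
  · simp; module
  · simp

-- Suppose r_σβ is negative. With k = ⟨σ^∨, β⟩ > 0, the root β' = kσ - β is positive and has the
-- same pairing k with σ. Subtracting σ from β or β' again leaves positive roots, and each k ∈ {1,
-- 2, 3} contradicts indecomposability or additivity of `affHeight`.
variable {b} in
lemma IsIndecomposable.mem_simpleRoots {σ : RealRoot ι} (h : IsIndecomposable b σ) :
    σ ∈ simpleRoots b := by
  refine ⟨h.1, fun β hβ hne => ?_⟩
  have hσ := (affHeight_pos_iff b σ).2 h.1
  have hβ' := (affHeight_pos_iff b β).2 hβ
  by_contra hneg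
  have hneg' : ¬ 0 < affHeight b (σ.refl P • β) := fun h' => hneg ((affHeight_pos_iff b _).1 h')
  have hht := affHeight_refl_smul b σ β
  have hk : 0 < P.pairingIn ℤ β.idx σ.idx := by
    by_contra! hk
    have := mul_nonneg_of_nonpos_of_nonpos hk (neg_nonpos.2 hσ.le)
    nlinarith
  -- the case of proportional finite parts
  have hidx : β.idx ≠ σ.idx := by
    intro hi
    apply hneg
    have hn := h.n_eq
    have hβn := (isPos_iff_posShift_le b β).1 hβ
    have hne' : β.n ≠ σ.n := by
      intro hn'
      apply hne
      obtain ⟨i, n⟩ := β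
      obtain ⟨j, m⟩ := σ
      simp_all
    rw [isPos_iff_posShift_le, RealRoot.refl_smul_idx, RealRoot.refl_smul_n, hi,
      posShift_reflectionPerm_self]
    simp only [RootPairing.pairingIn_same]
    rw [hi] at hβn
    omega
  have hidx' : P.root β.idx ≠ -P.root σ.idx := by
    intro hi
    have : β.idx = P.reflectionPerm σ.idx σ.idx := P.root.injective (by simpa using hi)
    rw [this] at hk
    simp at hk
  -- subtracting `σ` from a positive real root
  have hsub : ∀ γ : RealRoot ι, γ.IsPos b → γ.idx ≠ σ.idx →
      0 < P.pairingIn ℤ γ.idx σ.idx → ∃ τ : RealRoot ι, τ.IsPos b ∧ IsSum P γ σ τ := by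
    intro γ hγ hi hp
    obtain ⟨j, hj⟩ := P.root_sub_root_mem_of_pairingIn_pos hp hi
    by_cases hτ : (⟨j, γ.n - σ.n⟩ : RealRoot ι).IsPos b
    · exact ⟨_, hτ, by simp [hj], by simp⟩
    · rw [← isPos_negRoot_iff] at hτ
      refine absurd ⟨?_, ?_⟩ (h.2 _ _ hγ hτ).1
      · rw [negRoot, root_reflectionPerm_self, hj]; abel
      · simp [negRoot]
  set β' := negRoot P (σ.refl P • β) with hβ'def
  have hpos' : β'.IsPos b := (isPos_negRoot_iff b _).2 hneg
  have hroot' : P.root β'.idx = P.pairingIn ℤ β.idx σ.idx • P.root σ.idx - P.root β.idx := by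
    rw [hβ'def, negRoot, root_reflectionPerm_self, RealRoot.refl_smul_idx,
      RootPairing.root_reflectionPerm, RootPairing.reflection_apply_root' ℤ, neg_sub]
  have hn' : β'.n = P.pairingIn ℤ β.idx σ.idx * σ.n - β.n := by
    rw [hβ'def, negRoot, RealRoot.refl_smul_n]
    ring
  have hpair' : P.pairingIn ℤ β'.idx σ.idx = P.pairingIn ℤ β.idx σ.idx := by
    rw [hβ'def, negRoot, RealRoot.refl_smul_idx]
    simp [← RootPairing.pairingIn_reflectionPerm]
  have hidx2 : β'.idx ≠ σ.idx := by
    intro hi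
    apply hidx'
    have h2 : P.pairingIn ℤ β.idx σ.idx = 2 := by rw [← hpair', hi]; simp
    rw [hi, h2] at hroot'
    have h3 : P.root β.idx = P.root σ.idx := by
      rw [eq_sub_iff_add_eq, two_smul] at hroot'
      exact add_left_cancel hroot'
    exact absurd (P.root.injective h3) hidx
  obtain ⟨τ, hτ, hsum⟩ := hsub β hβ hidx hk
  obtain ⟨τ', hτ', hsum'⟩ := hsub β' hpos' hidx2 (hpair' ▸ hk)
  have e1 := hsum.affHeight (b := b)
  have e2 := hsum'.affHeight (b := b)
  have p1 := (affHeight_pos_iff b τ).2 hτ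
  have p2 := (affHeight_pos_iff b τ').2 hτ'
  have e3 : affHeight b β' = - affHeight b (σ.refl P • β) := affHeight_negRoot b _
  have hset := P.pairingIn_pairingIn_mem_set_of_isCrystal_of_isRed' β.idx σ.idx
    (fun hh => hidx (P.root.injective hh)) hidx'
  simp only [Set.mem_insert_iff, Set.mem_singleton_iff, Prod.mk.injEq] at hset
  have hk123 : P.pairingIn ℤ β.idx σ.idx = 1 ∨ P.pairingIn ℤ β.idx σ.idx = 2 ∨
      P.pairingIn ℤ β.idx σ.idx = 3 := by omega
  -- For k = 1, σ = β + β'. For k = 2, the positive roots τ = β - σ and τ' = β' - σ would sum to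
  -- zero. For k = 3, σ = τ + τ'.
  rcases hk123 with hk1 | hk1 | hk1 <;> rw [hk1] at hroot' hn' hht
  · refine (h.2 β β' hβ hpos').1 ⟨?_, ?_⟩
    · rw [hroot']; simp
    · rw [hn']; ring
  · omega
  · refine (h.2 τ τ' hτ hτ').1 ⟨?_, ?_⟩
    · have h1 := hsum.1
      have h2 := hsum'.1
      rw [hroot', h1] at h2
      have h3 : P.root τ'.idx = (3 : ℤ) • P.root σ.idx - (P.root σ.idx + P.root τ.idx)
        - P.root σ.idx := by rw [h2]; abel
      rw [h3]; module
    · have h1 := hsum.2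
      have h2 := hsum'.2
      omega

/-- Descent on `affHeight`: if β decomposes, one of the summands still pairs positively with the
fixed coroot. -/
lemma exists_mem_simpleRoots_pairingIn_pos (i : ι) (β : RealRoot ι) (hβ : β.IsPos b)
    (h : 0 < P.pairingIn ℤ β.idx i) :
    ∃ σ ∈ simpleRoots b, 0 < P.pairingIn ℤ σ.idx i := by
  induction hn : (affHeight b β).toNat using Nat.strong_induction_on generalizing β with
  | _ n ih =>
    subst hn
    by_cases hs : IsIndecomposable b β
    · exact ⟨β, hs.mem_simpleRoots, h⟩
    · have hs' : ∃ β₁ β₂ : RealRoot ι, β₁.IsPos b ∧ β₂.IsPos b ∧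
          (IsSum P β β₁ β₂ ∨ IsTwoSum P β β₁ β₂) := by
        unfold IsIndecomposable at hs
        push Not at hs
        obtain ⟨β₁, β₂, h₁, h₂, h₃⟩ := hs hβ
        exact ⟨β₁, β₂, h₁, h₂, by tauto⟩
      obtain ⟨β₁, β₂, h₁, h₂, h₃⟩ := hs'
      have p := (affHeight_pos_iff b β).2 hβ
      have p₁ := (affHeight_pos_iff b β₁).2 h₁
      have p₂ := (affHeight_pos_iff b β₂).2 h₂
      have key : affHeight b β₁ < affHeight b β ∧ affHeight b β₂ < affHeight b β ∧
          (0 < P.pairingIn ℤ β₁.idx i ∨ 0 < P.pairingIn ℤ β₂.idx i) := by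
        rcases h₃ with h₃ | h₃
        · have e := h₃.affHeight (b := b)
          have e' : P.pairingIn ℤ β.idx i = P.pairingIn ℤ β₁.idx i + P.pairingIn ℤ β₂.idx i := by
            have : P.pairing β.idx i = P.pairing β₁.idx i + P.pairing β₂.idx i := by
              simp only [← RootPairing.root_coroot_eq_pairing, h₃.1, map_add, LinearMap.add_apply]
            simp only [← coe_pairingIn] at this
            exact_mod_cast this
          refine ⟨by omega, by omega, by omega⟩
        · have e := h₃.affHeight (b := b)
          have e' : P.pairingIn ℤ β.idx i =
              P.pairingIn ℤ β₂.idx i + 2 * P.pairingIn ℤ β₁.idx i := by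
            have : P.pairing β.idx i = P.pairing β₂.idx i + 2 * P.pairing β₁.idx i := by
              simp only [← RootPairing.root_coroot_eq_pairing, h₃.1, map_add, map_zsmul,
                LinearMap.add_apply, LinearMap.smul_apply]
              simp
            simp only [← coe_pairingIn] at this
            exact_mod_cast this
          refine ⟨by omega, by omega, by omega⟩
      rcases key with ⟨k₁, k₂, k₃ | k₃⟩
      · exact ih _ (by omega) β₁ h₁ k₃ rfl
      · exact ih _ (by omega) β₂ h₂ k₃ rfl

lemma simpleRoot_n_eq {σ : RealRoot ι} (h : σ ∈ simpleRoots b) : σ.n = posShift b σ.idx := by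
  by_contra hne
  have h1 := (isPos_iff_posShift_le b σ).1 h.1
  have h2 := h.2 ⟨σ.idx, posShift b σ.idx⟩ ((isPos_mk_iff b _ _).2 le_rfl)
    (fun hh => hne (congrArg RealRoot.n hh).symm)
  rw [isPos_iff_posShift_le, RealRoot.refl_smul_idx, RealRoot.refl_smul_n] at h2
  simp only [posShift_reflectionPerm_self, RootPairing.pairingIn_same] at h2
  omega

/-- The effect of a simple reflection `r_σ` on the least positive shifts: the value for `α_i`
changes by `⟨σ^∨, α_i⟩` times the coefficient of `δ` in `σ`, unless `α_i` is proportional to the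
finite part of `σ`. -/
lemma posShift_reflectionPerm_simple {σ : RealRoot ι} (h : σ ∈ simpleRoots b) (i : ι)
    (h1 : i ≠ σ.idx) (h2 : i ≠ P.reflectionPerm σ.idx σ.idx) :
    posShift b (P.reflectionPerm σ.idx i) - posShift b i + σ.n * P.pairingIn ℤ i σ.idx = 0 := by
  -- Applying r_σ to the lowest positive root over i and to the one over its reflection gives two
  -- opposite inequalities.
  have a1 := h.2 ⟨i, posShift b i⟩ ((isPos_mk_iff b _ _).2 le_rfl)
    (fun hh => h1 (congrArg RealRoot.idx hh))
  have a2 := h.2 ⟨P.reflectionPerm σ.idx i, posShift b (P.reflectionPerm σ.idx i)⟩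
    ((isPos_mk_iff b _ _).2 le_rfl) (fun hh => h2 (by
      have hi : P.reflectionPerm σ.idx i = σ.idx := congrArg RealRoot.idx hh
      rw [← RootPairing.reflectionPerm_self P σ.idx i, hi]))
  rw [isPos_iff_posShift_le, RealRoot.refl_smul_idx, RealRoot.refl_smul_n] at a1 a2
  simp only [RootPairing.reflectionPerm_self] at a1 a2
  rw [← RootPairing.pairingIn_reflectionPerm, RootPairing.pairingIn_reflectionPerm_self_right] at a2
  have := mul_comm (P.pairingIn ℤ i σ.idx) σ.n
  rw [neg_mul] at a2
  omega

end Positive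

end SiLS

end

noncomputable section

namespace SiLS

/-! ### The length function of the finite Weyl group -/

section Length

variable {ι M N : Type*} [Fintype ι] [AddCommGroup M] [Module ℂ M] [AddCommGroup N] [Module ℂ N]
  {P : RootPairing ι ℂ M N} [P.IsCrystallographic] [P.IsReduced] (b : P.Base)

lemma ofIdx_smul_idx (i j : ι) :
    RootPairing.weylGroup.ofIdx P i • j = P.reflectionPerm i j := rfl

lemma weyl_smul_reflectionPerm_self (w : P.weylGroup) (i : ι) :
    w • P.reflectionPerm i i = P.reflectionPerm (w • i) (w • i) := by
  apply P.root.injective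
  rw [root_weyl_smul, root_reflectionPerm_self, root_reflectionPerm_self, root_weyl_smul]
  exact smul_neg (w : P.Aut) (P.root i)

lemma ofIdx_weyl_smul (w : P.weylGroup) (i : ι) :
    RootPairing.weylGroup.ofIdx P (w • i) = w * RootPairing.weylGroup.ofIdx P i * w⁻¹ :=
  congrArg AffineWeyl.fin
    (RealRoot.refl_smul_root (⟨w, 0⟩ : AffineWeyl P) (⟨i, 0⟩ : RealRoot ι))

lemma ofIdx_mul_self (i : ι) :
    RootPairing.weylGroup.ofIdx P i * RootPairing.weylGroup.ofIdx P i = 1 :=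
  congrArg AffineWeyl.fin (RealRoot.refl_mul_self (P := P) (⟨i, 0⟩ : RealRoot ι))

lemma ofIdx_reflectionPerm_self (i : ι) :
    RootPairing.weylGroup.ofIdx P (P.reflectionPerm i i) = RootPairing.weylGroup.ofIdx P i := by
  rw [← ofIdx_smul_idx, ofIdx_weyl_smul, ofIdx_mul_self, one_mul, inv_eq_of_mul_eq_one_left]
  exact ofIdx_mul_self i

/-- The product of a list of simple reflections. -/
def simpleProd (l : List b.support) : P.weylGroup :=
  (l.map fun i => RootPairing.weylGroup.ofIdx P (i : ι)).prod

lemma simpleProd_nil : simpleProd b [] = 1 := rfl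

lemma simpleProd_cons (i : b.support) (l : List b.support) :
    simpleProd b (i :: l) = RootPairing.weylGroup.ofIdx P (i : ι) * simpleProd b l := by
  simp [simpleProd]

lemma simpleProd_append (l l' : List b.support) :
    simpleProd b (l ++ l') = simpleProd b l * simpleProd b l' := by
  simp [simpleProd]

lemma exists_simpleProd_eq (w : P.weylGroup) : ∃ l, simpleProd b l = w := by
  have h : ∀ i, ∃ l, simpleProd b l = RootPairing.weylGroup.ofIdx P i := by
    intro i
    refine b.induction_reflect i (p := fun i => ∃ l, simpleProd b l =
      RootPairing.weylGroup.ofIdx P i) ?_ ?_ ?_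
    · intro i hi
      rwa [ofIdx_reflectionPerm_self]
    · intro i hi
      exact ⟨[⟨i, hi⟩], by simp [simpleProd]⟩
    · rintro i j ⟨l, hl⟩ hj
      refine ⟨⟨j, hj⟩ :: (l ++ [⟨j, hj⟩]), ?_⟩
      rw [simpleProd_cons, simpleProd_append, hl, ← ofIdx_smul_idx, ofIdx_weyl_smul,
        inv_eq_of_mul_eq_one_left (ofIdx_mul_self j)]
      simp [simpleProd, mul_assoc]
  obtain ⟨w, hw⟩ := w
  induction hw using RootPairing.weylGroup.induction with
  | mem i => exact h i
  | one => exact ⟨[], rfl⟩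
  | mul x y hx hy h₁ h₂ =>
    obtain ⟨l₁, e₁⟩ := h₁
    obtain ⟨l₂, e₂⟩ := h₂
    exact ⟨l₁ ++ l₂, by rw [simpleProd_append, e₁, e₂]; rfl⟩

/-- The exchange condition. -/
lemma exists_simpleProd_eq_mul (l : List b.support) (i : b.support)
    (h : ¬ b.IsPos (simpleProd b l • (i : ι))) :
    ∃ l' : List b.support, l'.length + 1 = l.length ∧
      simpleProd b l' = simpleProd b l * RootPairing.weylGroup.ofIdx P (i : ι) := by
  induction l with
  | nil =>
    rw [simpleProd_nil, one_smul] at h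
    exact absurd (RootPairing.Base.isPos_of_mem_support i.2) h
  | cons a l ih =>
    rw [simpleProd_cons] at h ⊢
    by_cases hw : b.IsPos (simpleProd b l • (i : ι))
    · have ha : simpleProd b l • (i : ι) = a := by
        by_contra hne
        rw [mul_smul, ofIdx_smul_idx] at h
        exact h (hw.reflectionPerm a.2 hne)
      refine ⟨l, rfl, ?_⟩
      rw [← ha, ofIdx_weyl_smul]
      simp [mul_assoc, ofIdx_mul_self]
    · obtain ⟨l', h₁, h₂⟩ := ih hw
      exact ⟨a :: l', by simp [h₁], by rw [simpleProd_cons, h₂, mul_assoc]⟩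

open scoped Classical in
/-- The number of inversions of an element of the finite Weyl group. -/
def inversions (w : P.weylGroup) : ℤ := ∑ i with b.IsPos i, posShift b (w • i)

lemma inversions_one : inversions b 1 = 0 := by
  classical
  unfold inversions
  refine Finset.sum_eq_zero fun i hi => ?_
  rw [one_smul, posShift, if_pos (Finset.mem_filter.1 hi).2]

/-- The reflection r_i permutes the positive roots other than α_i, so only the summand at i changes,
from 0 to 1. -/
lemma inversions_mul (w : P.weylGroup) {i : ι} (hi : i ∈ b.support) (h : b.IsPos (w • i)) :
    inversions b (w * RootPairing.weylGroup.ofIdx P i) = inversions b w + 1 := by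
  classical
  have hi' := RootPairing.Base.isPos_of_mem_support hi
  have hmem : i ∈ Finset.univ.filter fun i => b.IsPos i := by simpa using hi'
  unfold inversions
  rw [← Finset.add_sum_erase _ _ hmem, ← Finset.add_sum_erase _ _ hmem]
  have e1 : posShift b (w • i) = 0 := if_pos h
  have e2 : posShift b ((w * RootPairing.weylGroup.ofIdx P i) • i) = 1 := by
    have : (w * RootPairing.weylGroup.ofIdx P i) • i = P.reflectionPerm (w • i) (w • i) := by
      rw [← ofIdx_smul_idx, ofIdx_weyl_smul]
      simp [mul_smul]
    rw [this, posShift_reflectionPerm_self, e1, sub_zero]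
  rw [e1, e2, zero_add, add_comm]
  congr 1
  refine Finset.sum_nbij' (P.reflectionPerm i) (P.reflectionPerm i) ?_ ?_ ?_ ?_ ?_
  · intro j hj
    simp only [Finset.mem_erase, Finset.mem_filter, Finset.mem_univ, true_and] at hj ⊢
    have := hj.2.reflectionPerm hi hj.1
    refine ⟨fun he => ?_, this⟩
    have h2 : j = P.reflectionPerm i i := by
      rw [← RootPairing.reflectionPerm_self P i j, he]
    rw [h2, isPos_reflectionPerm_self_iff] at hj
    exact hj.2 hi'
  · intro j hj
    simp only [Finset.mem_erase, Finset.mem_filter, Finset.mem_univ, true_and] at hj ⊢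
    have := hj.2.reflectionPerm hi hj.1
    refine ⟨fun he => ?_, this⟩
    have h2 : j = P.reflectionPerm i i := by
      rw [← RootPairing.reflectionPerm_self P i j, he]
    rw [h2, isPos_reflectionPerm_self_iff] at hj
    exact hj.2 hi'
  · intro j _
    exact RootPairing.reflectionPerm_self P i j
  · intro j _
    exact RootPairing.reflectionPerm_self P i j
  · intro j _
    rw [mul_smul, ofIdx_smul_idx]

/-- In a word of minimal length each new letter i meets a prefix w with wα_i positive; otherwise
exchange would shorten the word. -/
lemma inversions_simpleProd (l : List b.support)
    (hl : ∀ l', simpleProd b l' = simpleProd b l → l.length ≤ l'.length) :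
    inversions b (simpleProd b l) = l.length := by
  induction l using List.reverseRecOn with
  | nil => rw [simpleProd_nil, inversions_one]; rfl
  | append_singleton l i ih =>
    have e : simpleProd b (l ++ [i]) =
        simpleProd b l * RootPairing.weylGroup.ofIdx P (i : ι) := by
      rw [simpleProd_append]
      simp [simpleProd]
    have hpos : b.IsPos (simpleProd b l • (i : ι)) := by
      by_contra hneg
      obtain ⟨l', h₁, h₂⟩ := exists_simpleProd_eq_mul b l i hneg
      have := hl l' (h₂.trans e.symm)
      simp at this
      omega
    rw [e, inversions_mul b _ i.2 hpos, ih]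
    · simp
    · intro l' hl'
      have := hl (l' ++ [i]) (by rw [simpleProd_append, simpleProd_append, hl'])
      simpa using this

/-- The length of an element of the finite Weyl group is its number of inversions. -/
lemma coe_length (w : P.weylGroup) : (length b w : ℤ) = inversions b w := by
  obtain ⟨l, hl⟩ := exists_simpleProd_eq b w
  have hmem := Nat.sInf_mem (s := {k | ∃ l : List b.support, l.length = k ∧
    (l.map fun i => RootPairing.weylGroup.ofIdx P (i : ι)).prod = w}) ⟨l.length, l, rfl, hl⟩
  obtain ⟨l', h₁, h₂⟩ := hmem
  change l'.length = length b w at h₁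
  change simpleProd b l' = w at h₂
  rw [← h₁, ← h₂]
  refine (inversions_simpleProd b l' fun l'' h => ?_).symm
  rw [h₁]
  exact Nat.sInf_le ⟨l'', rfl, h.trans h₂⟩

end Length

/-! ### Dominant weights -/

section Dominant

variable {ι M N : Type*} [Fintype ι] [AddCommGroup M] [Module ℂ M] [AddCommGroup N] [Module ℂ N]
  {P : RootPairing ι ℂ M N} [P.IsCrystallographic] [P.IsReduced] {b : P.Base}
  {lam : LevelZeroWeight M}

lemma IsDominant.exists_pairing (hlam : IsDominant b lam) (i : ι) :
    ∃ z : ℤ, P.toLinearMap lam.fin (P.coroot i) = z := by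
  have h := b.coroot_mem_span_int i
  generalize P.coroot i = x at h
  induction h using Submodule.span_induction with
  | mem x hx =>
    obtain ⟨j, hj, rfl⟩ := hx
    obtain ⟨m, hm⟩ := hlam j hj
    exact ⟨m, by rw [hm]; simp⟩
  | zero => exact ⟨0, by simp⟩
  | add x y _ _ hx hy =>
    obtain ⟨a, ha⟩ := hx
    obtain ⟨c, hc⟩ := hy
    exact ⟨a + c, by simp_all⟩
  | smul n x _ hx =>
    obtain ⟨a, ha⟩ := hx
    exact ⟨n * a, by simp_all⟩

/-- The integer `⟨α_i^∨, λ⟩`. -/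
def IsDominant.pairing (hlam : IsDominant b lam) (i : ι) : ℤ := (hlam.exists_pairing i).choose

lemma IsDominant.coe_pairing (hlam : IsDominant b lam) (i : ι) :
    (hlam.pairing i : ℂ) = P.toLinearMap lam.fin (P.coroot i) :=
  (hlam.exists_pairing i).choose_spec.symm

lemma IsDominant.pairing_reflectionPerm_self (hlam : IsDominant b lam) (i : ι) :
    hlam.pairing (P.reflectionPerm i i) = -hlam.pairing i := by
  refine Int.cast_injective (α := ℂ) ?_
  rw [Int.cast_neg, hlam.coe_pairing, hlam.coe_pairing]
  simp

/-- The squared length of a root for the canonical form. -/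
def sqLength (P : RootPairing ι ℂ M N) [P.IsCrystallographic] (i : ι) : ℤ :=
  ∑ j, P.pairingIn ℤ i j * P.pairingIn ℤ i j

lemma sqLength_pos (i : ι) : 0 < sqLength P i := by
  refine Finset.sum_pos' (fun j _ => mul_self_nonneg _) ⟨i, Finset.mem_univ _, ?_⟩
  simp

/-- Coroots are not additive in the roots, but |α|²α^∨ is. This is what transfers expansions in
simple roots to pairings with λ. -/
lemma IsDominant.sqLength_mul_pairing (hlam : IsDominant b lam) (i : ι) :
    ((sqLength P i * hlam.pairing i : ℤ) : ℂ) = 2 * P.RootForm (P.root i) lam.fin := by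
  have h := congrArg (P.toLinearMap lam.fin) (P.rootForm_self_smul_coroot i)
  rw [map_smul, map_nsmul, P.toLinearMap_apply_apply_Polarization, P.rootForm_root_self,
    ← hlam.coe_pairing] at h
  rw [Int.cast_mul, sqLength, Int.cast_sum]
  simp only [Int.cast_mul, coe_pairingIn]
  simpa using h

lemma IsDominant.pairing_eq_zero_of_mem_span (hlam : IsDominant b lam) {i : ι}
    (h : P.root i ∈ Submodule.span ℤ (P.root '' stabSet b lam)) : hlam.pairing i = 0 := by
  have key : ∀ x ∈ Submodule.span ℤ (P.root '' stabSet b lam), P.RootForm x lam.fin = 0 := by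
    intro x hx
    induction hx using Submodule.span_induction with
    | mem x hx =>
      obtain ⟨j, hj, rfl⟩ := hx
      have h1 := hlam.sqLength_mul_pairing j
      have h2 := hlam.coe_pairing j
      rw [hj.2] at h2
      rw [Int.cast_mul, h2, mul_zero] at h1
      simpa using h1.symm
    | zero => simp
    | add x y _ _ hx hy => simp [hx, hy]
    | smul n x _ hx => simp [hx]
  have h1 := hlam.sqLength_mul_pairing i
  rw [key _ h, mul_zero, Int.cast_eq_zero, mul_eq_zero] at h1
  exact h1.resolve_left (sqLength_pos i).ne'

/-- After rescaling by squared lengths, the pairing is a sum of nonnegative terms over the simple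
roots. If it vanishes, every simple root that occurs lies in J. -/
lemma IsDominant.pairing_nonneg_and (hlam : IsDominant b lam) {i : ι} (hi : b.IsPos i) :
    0 ≤ hlam.pairing i ∧ (hlam.pairing i = 0 →
      P.root i ∈ Submodule.span ℤ (P.root '' stabSet b lam)) := by
  obtain ⟨f, hf₀, hf₁, hf₂⟩ := b.exists_root_eq_sum_int i
  replace hf₁ : 0 ≤ f := by
    refine (hf₁.resolve_right fun hneg => ?_).le
    rw [RootPairing.Base.isPos_iff, RootPairing.Base.height_eq_sum hf₂] at hi
    exact absurd hi (not_lt.2 (Finset.sum_nonpos fun j _ => hneg.le j))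
  have hnn : ∀ j ∈ b.support, 0 ≤ hlam.pairing j := by
    intro j hj
    obtain ⟨m, hm⟩ := hlam j hj
    have := hlam.coe_pairing j
    rw [hm] at this
    have h2 : hlam.pairing j = m := by exact_mod_cast this
    omega
  have hsum : sqLength P i * hlam.pairing i =
      ∑ j ∈ b.support, f j * (sqLength P j * hlam.pairing j) := by
    refine Int.cast_injective (α := ℂ) ?_
    rw [hlam.sqLength_mul_pairing, hf₂, Int.cast_sum]
    simp only [Int.cast_mul (f _), hlam.sqLength_mul_pairing, map_sum, map_zsmul,
      LinearMap.sum_apply, LinearMap.smul_apply, Finset.mul_sum, zsmul_eq_mul]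
    exact Finset.sum_congr rfl fun j _ => by ring
  have hterm : ∀ j ∈ b.support, 0 ≤ f j * (sqLength P j * hlam.pairing j) := fun j hj =>
    mul_nonneg (hf₁ j) (mul_nonneg (sqLength_pos j).le (hnn j hj))
  refine ⟨?_, fun h0 => ?_⟩
  · have h1 := Finset.sum_nonneg hterm
    rw [← hsum] at h1
    exact nonneg_of_mul_nonneg_right h1 (sqLength_pos i)
  · rw [h0, mul_zero] at hsum
    have h1 := (Finset.sum_eq_zero_iff_of_nonneg hterm).1 hsum.symm
    rw [hf₂]
    refine Submodule.sum_mem _ fun j hj => ?_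
    rcases mul_eq_zero.1 (h1 j hj) with h2 | h2
    · rw [h2, zero_smul]
      exact Submodule.zero_mem _
    · have h3 := (mul_eq_zero.1 h2).resolve_left (sqLength_pos j).ne'
      refine Submodule.smul_mem _ _ (Submodule.subset_span ⟨j, ⟨hj, ?_⟩, rfl⟩)
      rw [← hlam.coe_pairing, h3, Int.cast_zero]

lemma IsDominant.isPos_of_pairing_pos (hlam : IsDominant b lam) {i : ι} (h : 0 < hlam.pairing i) :
    b.IsPos i := by
  by_contra hi
  rw [← isPos_reflectionPerm_self_iff] at hi
  have := (hlam.pairing_nonneg_and hi).1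
  rw [hlam.pairing_reflectionPerm_self] at this
  omega

/-- The value of a coroot on a weight in the orbit of `λ`. -/
lemma IsDominant.copair_smul (hlam : IsDominant b lam) (x : AffineWeyl P) (β : RealRoot ι) :
    β.copair P (x • lam) = hlam.pairing (x.fin⁻¹ • β.idx) := by
  have := RealRoot.copair_smul x (x⁻¹ • β) lam
  rw [smul_inv_smul] at this
  rw [this, hlam.coe_pairing]
  rfl

lemma IsDominant.exists_copair (hlam : IsDominant b lam) (β : RealRoot ι)
    (μ : MulAction.orbit (AffineWeyl P) lam) :
    ∃ z : ℤ, β.copair P (μ : LevelZeroWeight M) = z := by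
  obtain ⟨_, x, rfl⟩ := μ
  exact ⟨_, hlam.copair_smul x β⟩

/-- The integer `⟨β^∨, μ⟩` for a weight `μ` in the orbit of `λ`. -/
def IsDominant.orbitPairing (hlam : IsDominant b lam) (β : RealRoot ι)
    (μ : MulAction.orbit (AffineWeyl P) lam) : ℤ := (hlam.exists_copair β μ).choose

lemma IsDominant.coe_orbitPairing (hlam : IsDominant b lam) (β : RealRoot ι)
    (μ : MulAction.orbit (AffineWeyl P) lam) :
    (hlam.orbitPairing β μ : ℂ) = β.copair P (μ : LevelZeroWeight M) :=
  (hlam.exists_copair β μ).choose_spec.symm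

end Dominant

/-! ### The semi-infinite length -/

section SemiInfiniteLength

variable {ι M N : Type*} [Fintype ι] [AddCommGroup M] [Module ℂ M] [AddCommGroup N] [Module ℂ N]
  {P : RootPairing ι ℂ M N} [P.IsCrystallographic] [P.IsReduced] {b : P.Base}
  {lam : LevelZeroWeight M}

open scoped Classical in
/-- The contribution of the positive roots outside `Δ_J` to the semi-infinite length. -/
def IsDominant.relLength (hlam : IsDominant b lam) (x : AffineWeyl P) : ℤ :=
  ∑ i with b.IsPos i ∧ hlam.pairing i ≠ 0, (posShift b (x.fin • i) + latticePairing x.trans i)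

lemma latticePairing_add (ξ ζ : CorootLattice P) (i : ι) :
    latticePairing (ξ + ζ) i = latticePairing ξ i + latticePairing ζ i := by
  refine Int.cast_injective (α := ℂ) ?_
  simp [coe_latticePairing]

lemma latticePairing_invAct (w : P.weylGroup) (n : ℤ) (i j : ι) :
    latticePairing (invAct P w (n • P.corootSpanMem ℤ i)) j = n * P.pairingIn ℤ (w • j) i := by
  refine Int.cast_injective (α := ℂ) ?_
  rw [coe_latticePairing, pairing_invAct, ← root_weyl_smul, Int.cast_mul, coe_pairingIn]
  simp

/-- With α the finite part of σ and γ = v⁻¹α, where v is the finite part of x, only the summands of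
γ and -γ change, by +1 and -1. The sum contains γ iff ⟨γ^∨, λ⟩ > 0 and -γ iff ⟨γ^∨, λ⟩ < 0, which
leaves exactly the sign. -/
lemma IsDominant.relLength_refl_mul (hlam : IsDominant b lam) {σ : RealRoot ι}
    (hσ : σ ∈ simpleRoots b) (x : AffineWeyl P) :
    hlam.relLength (σ.refl P * x) =
      hlam.relLength x + (hlam.pairing (x.fin⁻¹ • σ.idx)).sign := by
  classical
  set γ := x.fin⁻¹ • σ.idx with hγ
  have hγ' : x.fin • γ = σ.idx := smul_inv_smul _ _
  have hneg : x.fin • P.reflectionPerm γ γ = P.reflectionPerm σ.idx σ.idx := by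
    rw [weyl_smul_reflectionPerm_self, hγ']
  have hne : γ ≠ P.reflectionPerm γ γ := by
    intro h
    have := isPos_reflectionPerm_self_iff b γ
    rw [← h] at this
    tauto
  have hterm : ∀ i, posShift b ((σ.refl P * x).fin • i) + latticePairing (σ.refl P * x).trans i =
      (posShift b (x.fin • i) + latticePairing x.trans i) +
        ((if i = γ then 1 else 0) - (if i = P.reflectionPerm γ γ then 1 else 0)) := by
    intro i
    have e1 : (σ.refl P * x).fin • i = P.reflectionPerm σ.idx (x.fin • i) := by
      rw [AffineWeyl.mul_fin, mul_smul]; rfl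
    rw [e1, AffineWeyl.mul_trans, latticePairing_add]
    change _ + (latticePairing (invAct P x.fin (σ.n • P.corootSpanMem ℤ σ.idx)) i + _) = _
    rw [latticePairing_invAct]
    have hn := simpleRoot_n_eq b hσ
    by_cases h1 : i = γ
    · rw [if_pos h1, if_neg (h1 ▸ hne), h1, hγ', posShift_reflectionPerm_self, hn,
        RootPairing.pairingIn_same]
      ring
    by_cases h2 : i = P.reflectionPerm γ γ
    · rw [if_neg h1, if_pos h2, h2, hneg, RootPairing.reflectionPerm_self,
        posShift_reflectionPerm_self, hn, RootPairing.pairingIn_reflectionPerm_self_left,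
        RootPairing.pairingIn_same]
      ring
    · rw [if_neg h1, if_neg h2]
      have := posShift_reflectionPerm_simple b hσ (x.fin • i)
        (fun h => h1 (by rw [hγ, ← h, inv_smul_smul]))
        (fun h => h2 (by rw [← hneg] at h; exact smul_left_cancel _ h))
      omega
  unfold IsDominant.relLength
  rw [Finset.sum_congr rfl fun i _ => hterm i, Finset.sum_add_distrib]
  congr 1
  rw [Finset.sum_sub_distrib, Finset.sum_ite_eq', Finset.sum_ite_eq']
  simp only [Finset.mem_filter, Finset.mem_univ, true_and, isPos_reflectionPerm_self_iff,
    hlam.pairing_reflectionPerm_self]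
  rcases lt_trichotomy (hlam.pairing γ) 0 with h | h | h
  · have : ¬ b.IsPos γ := fun hp => by
      have := (hlam.pairing_nonneg_and hp).1
      omega
    rw [Int.sign_eq_neg_one_of_neg h, if_neg (by tauto), if_pos ⟨this, by omega⟩]
    rfl
  · simp [h]
  · have := hlam.isPos_of_pairing_pos h
    rw [Int.sign_eq_one_of_pos h, if_pos ⟨this, h.ne'⟩, if_neg (by tauto)]
    rfl

lemma coe_siLength (x : AffineWeyl P) [DecidablePred b.IsPos] :
    siLength b x =
      ((∑ i with b.IsPos i, (posShift b (x.fin • i) + latticePairing x.trans i) : ℤ) : ℂ) := by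
  rw [Finset.sum_add_distrib, Int.cast_add, siLength]
  congr 1
  · have := coe_length b x.fin
    rw [← Int.cast_natCast, this]
    congr 1
    unfold inversions
    congr!
  · rw [rho, map_smul, LinearMap.smul_apply, map_sum, LinearMap.sum_apply, Int.cast_sum,
      smul_eq_mul, ← mul_assoc]
    simp only [coe_latticePairing]
    rw [mul_one_div_cancel two_ne_zero, one_mul]
    congr!

lemma mem_petersonReps_iff {J : Set ι} {x : AffineWeyl P} :
    x ∈ petersonReps b J ↔ ∀ β ∈ parabolicRoots P J, β.IsPos b → (x • β).IsPos b := by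
  refine forall₃_congr fun β hβ hp => ⟨?_, fun h => ⟨_, h, (RealRoot.toWeight_smul x β).symm⟩⟩
  rintro ⟨γ, hγ, h⟩
  rw [← RealRoot.toWeight_smul] at h
  rwa [RealRoot.toWeight_injective h]

/-- On `(W^J)_af`, the semi-infinite length is given by the positive roots outside `Δ_J`. -/
lemma IsDominant.siLength_eq (hlam : IsDominant b lam) {x : AffineWeyl P}
    (hx : x ∈ petersonReps b (stabSet b lam)) : siLength b x = hlam.relLength x := by
  classical
  rw [coe_siLength, IsDominant.relLength, ← Finset.filter_filter]
  congr 1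
  refine (Finset.sum_filter_of_ne (p := fun i => hlam.pairing i ≠ 0) fun i hi h0 hc => h0 ?_).symm
  have hpos := (Finset.mem_filter.1 hi).2
  have hspan := (hlam.pairing_nonneg_and hpos).2 hc
  rw [mem_petersonReps_iff] at hx
  have s0 : posShift b i = 0 := if_pos hpos
  -- For α ∈ Δ_J positive, positivity of xα and of x(-α + δ) bounds the summand of α from above and
  -- below by 0.
  have h1 := hx ⟨i, 0⟩ hspan ((isPos_mk_iff b _ _).2 s0.le)
  have h2 := hx ⟨P.reflectionPerm i i, 1⟩ (by
    rw [parabolicRoots, Set.mem_ofPred_eq, root_reflectionPerm_self]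
    exact Submodule.neg_mem _ hspan)
    ((isPos_mk_iff b _ _).2 (posShift_le_one b _))
  rw [isPos_iff_posShift_le, RealRoot.smul_idx, RealRoot.smul_n] at h1 h2
  have e1 : latticePairing x.trans (P.reflectionPerm i i) = - latticePairing x.trans i := by
    refine Int.cast_injective (α := ℂ) ?_
    rw [Int.cast_neg, coe_latticePairing, coe_latticePairing, root_reflectionPerm_self]
    simp
  simp only [e1, weyl_smul_reflectionPerm_self, posShift_reflectionPerm_self] at h1 h2
  omega

end SemiInfiniteLength

end SiLS

end

noncomputable section

namespace SiLS

/-! ### Comparison of the two orders -/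

section Comparison

variable {ι M N : Type*} [Fintype ι] [AddCommGroup M] [Module ℂ M] [AddCommGroup N] [Module ℂ N]
  {P : RootPairing ι ℂ M N} [P.IsRootSystem] [P.IsCrystallographic] [P.IsReduced] {b : P.Base}
  {lam : LevelZeroWeight M}

/-- The linear functional on the weight space which takes the value `1` on the simple roots. -/
def heightFunctional (b : P.Base) : M →ₗ[ℂ] ℂ := b.toWeightBasis.constr ℂ fun _ => (1 : ℂ)

lemma heightFunctional_root (i : ι) : heightFunctional b (P.root i) = b.height i := by
  obtain ⟨f, -, -, hf⟩ := b.exists_root_eq_sum_int i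
  rw [RootPairing.Base.height_eq_sum hf, hf, map_sum, Int.cast_sum]
  refine Finset.sum_congr rfl fun j hj => ?_
  have : heightFunctional b (P.root j) = 1 := by
    have := b.toWeightBasis.constr_basis ℂ (fun _ => (1 : ℂ)) ⟨j, hj⟩
    rwa [b.toWeightBasis_apply] at this
  rw [map_zsmul, this]
  simp

/-- A height function on level-zero weights. -/
def weightDegree (b : P.Base) (μ : LevelZeroWeight M) : ℂ :=
  heightFunctional b μ.fin + μ.del * (1 + ∑ i, |b.height i| : ℤ)

lemma weightDegree_refl_smul (β : RealRoot ι) (μ : LevelZeroWeight M) :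
    weightDegree b (β.refl P • μ) = weightDegree b μ - β.copair P μ * affHeight b β := by
  rw [RealRoot.refl_smul, weightDegree, weightDegree, affHeight]
  simp only [RealRoot.toWeight, map_sub, map_smul, heightFunctional_root, smul_eq_mul]
  push_cast
  ring

/-- The action of the affine Weyl group on the real roots and on the orbit of `λ`. -/
def IsDominant.reflectionAction (hlam : IsDominant b lam) :
    ReflectionAction (AffineWeyl P) (RealRoot ι) (MulAction.orbit (AffineWeyl P) lam) where
  refl β := β.refl P
  pos := {β | β.IsPos b}
  simple := simpleRoots b
  pair := hlam.orbitPairing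
  cartan σ β := P.pairingIn ℤ β.idx σ.idx
  ht β := (affHeight b β).toNat
  -- The degree of λ itself may be complex; only differences within the orbit matter, and along
  -- reflections these are integers.
  deg μ := (weightDegree b (μ : LevelZeroWeight M)).re
  refl_mul_self := RealRoot.refl_mul_self
  refl_smul := RealRoot.refl_smul_root
  pair_smul g β μ := by
    refine Int.cast_injective (α := ℂ) ?_
    rw [hlam.coe_orbitPairing, hlam.coe_orbitPairing]
    exact RealRoot.copair_smul g β μ
  pair_refl σ β μ := by
    refine Int.cast_injective (α := ℂ) ?_
    rw [Int.cast_sub, Int.cast_mul]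
    simp only [hlam.coe_orbitPairing]
    exact RealRoot.copair_refl_smul σ β (μ : LevelZeroWeight M)
  cartan_self β := by simp
  refl_smul_of_pair_eq_zero β μ h := by
    refine Subtype.ext ?_
    have h' := hlam.coe_orbitPairing β μ
    rw [h, Int.cast_zero] at h'
    refine (RealRoot.refl_smul β μ.1).trans ?_
    rw [← h']
    simp
  simple_pos := fun σ hσ => hσ.1
  refl_simple_smul_mem := fun σ hσ β hβ hne => hσ.2 β hβ hne
  exists_simple β hβ hβ' := by
    obtain ⟨σ, hσ, h⟩ := exists_mem_simpleRoots_pairingIn_pos b β.idx β hβ (by simp)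
    have hc : 0 < P.pairingIn ℤ β.idx σ.idx := (P.zero_lt_pairingIn_iff' ℤ).1 h
    have hne : β ≠ σ := by rintro rfl; exact hβ' hσ
    refine ⟨σ, hσ, hc, ?_⟩
    have h1 := affHeight_refl_smul b σ β
    have h2 := mul_pos hc ((affHeight_pos_iff b σ).2 hσ.1)
    have h3 := (affHeight_pos_iff b β).2 hβ
    omega
  deg_refl_lt β hβ μ h := by
    change (weightDegree b (β.refl P • (μ : LevelZeroWeight M))).re < _
    rw [weightDegree_refl_smul, ← hlam.coe_orbitPairing, ← Int.cast_mul, Complex.sub_re,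
      Complex.intCast_re]
    have : 0 < hlam.orbitPairing β μ * affHeight b β :=
      mul_pos h ((affHeight_pos_iff b β).2 hβ)
    have : (0 : ℝ) < ((hlam.orbitPairing β μ * affHeight b β : ℤ) : ℝ) := by exact_mod_cast this
    linarith

variable (hlam : IsDominant b lam)

/-- The weight `λ` as an element of its orbit. -/
def basePoint (P : RootPairing ι ℂ M N) (lam : LevelZeroWeight M) :
    MulAction.orbit (AffineWeyl P) lam := ⟨lam, MulAction.mem_orbit_self lam⟩

lemma lStep_iff (β : RealRoot ι) (μ ν : MulAction.orbit (AffineWeyl P) lam) :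
    LStep b β μ ν ↔ hlam.reflectionAction.Step β μ ν := by
  refine and_congr Iff.rfl (and_congr ?_ ?_)
  · exact (Subtype.ext_iff (a1 := ν) (a2 := β.refl P • μ)).symm
  rw [← hlam.coe_orbitPairing]
  constructor
  · rintro ⟨m, hm, h⟩
    rw [Int.cast_inj] at h
    change 0 < hlam.orbitPairing β μ
    rwa [h]
  · exact fun h => ⟨_, h, rfl⟩

lemma lLE_iff (μ ν : MulAction.orbit (AffineWeyl P) lam) :
    LLE b μ ν ↔ hlam.reflectionAction.Le μ ν := by
  unfold LLE ReflectionAction.Le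
  simp only [lStep_iff hlam]

lemma lCovers_iff (μ ν : MulAction.orbit (AffineWeyl P) lam) :
    LCovers b μ ν ↔ hlam.reflectionAction.Covers μ ν := by
  unfold LCovers LLT ReflectionAction.Covers
  simp only [lLE_iff hlam]

lemma pair_smul_basePoint (β : RealRoot ι) (x : AffineWeyl P) :
    hlam.reflectionAction.pair β (x • basePoint P lam) = hlam.pairing (x.fin⁻¹ • β.idx) := by
  refine Int.cast_injective (α := ℂ) ((hlam.coe_orbitPairing β _).trans ?_)
  exact hlam.copair_smul x β

lemma isLengthFunction_relLength :
    hlam.reflectionAction.IsLengthFunction (basePoint P lam) hlam.relLength := by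
  intro σ hσ x
  rw [pair_smul_basePoint]
  exact hlam.relLength_refl_mul hσ x

/-- Only σ itself can be made negative by r_σ, and σ = xβ with β ∈ (Δ_J)_af would give ⟨σ^∨, xλ⟩ =
⟨β^∨, λ⟩ = 0. -/
lemma refl_mul_mem_petersonReps {σ : RealRoot ι} (hσ : σ ∈ simpleRoots b) {x : AffineWeyl P}
    (hx : x ∈ petersonReps b (stabSet b lam))
    (h : hlam.reflectionAction.pair σ (x • basePoint P lam) ≠ 0) :
    σ.refl P * x ∈ petersonReps b (stabSet b lam) := by
  rw [mem_petersonReps_iff] at hx ⊢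
  intro β hβ hp
  rw [mul_smul]
  refine hσ.2 _ (hx β hβ hp) fun he => h ?_
  rw [pair_smul_basePoint, ← he, RealRoot.smul_idx, inv_smul_smul]
  exact hlam.pairing_eq_zero_of_mem_span hβ

lemma one_mem_petersonReps (J : Set ι) : (1 : AffineWeyl P) ∈ petersonReps b J := by
  rw [mem_petersonReps_iff]
  intro β _ h
  rwa [one_smul]

lemma closure_refl_pos (b : P.Base) :
    Subgroup.closure {g : AffineWeyl P | ∃ β ∈ {β : RealRoot ι | β.IsPos b}, g = β.refl P} = ⊤ := by
  rw [eq_top_iff, ← closure_range_refl, Subgroup.closure_le]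
  rintro _ ⟨β, rfl⟩
  by_cases hβ : β.IsPos b
  · exact Subgroup.subset_closure ⟨β, hβ, rfl⟩
  · rw [← isPos_negRoot_iff] at hβ
    refine Subgroup.subset_closure ⟨_, hβ, ?_⟩
    have := RealRoot.refl_smul_root (β.refl P) β
    rw [RealRoot.refl_smul_self, RealRoot.refl_mul_self, one_mul,
      inv_eq_of_mul_eq_one_left (RealRoot.refl_mul_self β)] at this
    exact this.symm

include hlam in
/-- Every weight in the orbit of `λ` is of the form `x λ` with `x ∈ (W^J)_af`. -/
lemma exists_petersonRep (μ : MulAction.orbit (AffineWeyl P) lam) :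
    ∃ x : petersonReps b (stabSet b lam), (x : AffineWeyl P) • basePoint P lam = μ := by
  obtain ⟨_, g, rfl⟩ := μ
  obtain ⟨x, hx, h⟩ := hlam.reflectionAction.exists_mem_smul_eq (μ₀ := basePoint P lam)
    (K := petersonReps b (stabSet b lam))
    (fun σ hσ x hx h => refl_mul_mem_petersonReps hlam hσ hx h) (one_mem_petersonReps _)
    (fun g => by
      change g ∈ Subgroup.closure
        {g : AffineWeyl P | ∃ β ∈ {β : RealRoot ι | β.IsPos b}, g = β.refl P}
      rw [closure_refl_pos b]
      exact Subgroup.mem_top g) g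
  exact ⟨⟨x, hx⟩, h⟩

include hlam in
/-- An edge of the semi-infinite Bruhat graph is sent to a covering step. -/
lemma SiEdge.lStep_and_lCovers {β : RealRoot ι} {x y : petersonReps b (stabSet b lam)}
    (h : SiEdge b β x y) :
    LStep b β ((x : AffineWeyl P) • basePoint P lam) ((y : AffineWeyl P) • basePoint P lam) ∧
      LCovers b ((x : AffineWeyl P) • basePoint P lam)
        ((y : AffineWeyl P) • basePoint P lam) := by
  obtain ⟨hβ, hy, hl⟩ := h
  rw [hlam.siLength_eq x.2, hlam.siLength_eq y.2] at hl
  have hl' : hlam.relLength y = hlam.relLength x + 1 := by exact_mod_cast hl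
  rw [hy] at hl' ⊢
  have hf := isLengthFunction_relLength hlam
  have hpair := hf.pair_pos (β := β) hβ (x := x) (by
    change hlam.relLength x < hlam.relLength (β.refl P * x)
    omega)
  rw [mul_smul, lStep_iff hlam, lCovers_iff hlam]
  exact ⟨⟨hβ, rfl, hpair⟩, (hf.covers_iff β hβ x hpair).2 hl'⟩

include hlam in
/-- A covering step starting from `x λ` with `x ∈ (W^J)_af` lifts to an edge of the semi-infinite
Bruhat graph starting from `x`. -/
lemma exists_siEdge_of_lCovers {β : RealRoot ι} {x : petersonReps b (stabSet b lam)}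
    {ν : MulAction.orbit (AffineWeyl P) lam}
    (hs : LStep b β ((x : AffineWeyl P) • basePoint P lam) ν)
    (hc : LCovers b ((x : AffineWeyl P) • basePoint P lam) ν) :
    ∃ y : petersonReps b (stabSet b lam), (y : AffineWeyl P) • basePoint P lam = ν ∧
      SiEdge b β x y := by
  rw [lStep_iff hlam] at hs
  rw [lCovers_iff hlam] at hc
  obtain ⟨hβ, rfl, hpair⟩ := hs
  have hmem : β.refl P * x ∈ petersonReps b (stabSet b lam) :=
    ReflectionAction.refl_mul_mem_of_covers (D := hlam.reflectionAction)
      (fun σ hσ x hx h => refl_mul_mem_petersonReps hlam hσ hx h) β hβ x x.2 hpair hc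
  have hl : hlam.relLength (β.refl P * x) = hlam.relLength x + 1 :=
    ((isLengthFunction_relLength hlam).covers_iff β hβ x hpair).1 hc
  have hl' : siLength b (β.refl P * x) = siLength b (x : AffineWeyl P) + 1 := by
    rw [hlam.siLength_eq x.2, hlam.siLength_eq hmem, hl, Int.cast_add, Int.cast_one]
  exact ⟨⟨β.refl P * x, hmem⟩, mul_smul (β.refl P) (x : AffineWeyl P) (basePoint P lam),
    hβ, rfl, hl'⟩

include hlam in
lemma SiEdgeAt.lEdgeAt {a : ℚ} {x y : petersonReps b (stabSet b lam)}
    (h : SiEdgeAt b lam a x y) :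
    LEdgeAt b lam a ((x : AffineWeyl P) • basePoint P lam)
      ((y : AffineWeyl P) • basePoint P lam) := by
  obtain ⟨β, hβ, hk⟩ := h
  have := hβ.lStep_and_lCovers hlam
  exact ⟨this.2, β, this.1, hk⟩

include hlam in
lemma exists_siEdgeAt_path {a : ℚ} {μ ν : MulAction.orbit (AffineWeyl P) lam}
    (h : Relation.ReflTransGen (LEdgeAt b lam a) μ ν) {x : petersonReps b (stabSet b lam)}
    (hx : (x : AffineWeyl P) • basePoint P lam = μ) :
    ∃ y : petersonReps b (stabSet b lam), (y : AffineWeyl P) • basePoint P lam = ν ∧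
      Relation.ReflTransGen (SiEdgeAt b lam a) x y := by
  induction h with
  | refl => exact ⟨x, hx, Relation.ReflTransGen.refl⟩
  | tail _ h ih =>
    obtain ⟨y, rfl, hxy⟩ := ih
    obtain ⟨hc, β, hs, hk⟩ := h
    obtain ⟨z, hz, hyz⟩ := exists_siEdge_of_lCovers hlam hs hc
    exact ⟨z, hz, hxy.tail ⟨β, hyz, hk⟩⟩

include hlam in
/-- The map `x ↦ x λ` is strictly increasing on `(W^J)_af`. -/
lemma SiLE.lLT {x y : petersonReps b (stabSet b lam)} (h : SiLE b x y) (hne : x ≠ y) :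
    LLT b ((x : AffineWeyl P) • basePoint P lam) ((y : AffineWeyl P) • basePoint P lam) := by
  have hle : ∀ {x y : petersonReps b (stabSet b lam)}, SiLE b x y → hlam.reflectionAction.Le
      ((x : AffineWeyl P) • basePoint P lam) ((y : AffineWeyl P) • basePoint P lam) := by
    intro x y h
    exact Relation.ReflTransGen.lift (fun x : petersonReps b (stabSet b lam) =>
      (x : AffineWeyl P) • basePoint P lam) (fun x y hxy => by
      obtain ⟨β, hβ⟩ := hxy
      exact ⟨β, (lStep_iff hlam _ _ _).1 (hβ.lStep_and_lCovers hlam).1⟩) _ _ h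
  refine ⟨(lLE_iff hlam _ _).2 (hle h), fun he => ?_⟩
  -- If the images coincided, the first edge would be a strict step and the rest of the path would
  -- lead back below it.
  rcases Relation.ReflTransGen.cases_head h with rfl | ⟨z, ⟨β, hβ⟩, hz⟩
  · exact hne rfl
  · have hs := (lStep_iff hlam _ _ _).1 (hβ.lStep_and_lCovers hlam).1
    have h2 := hle hz
    rw [← he] at h2
    exact hs.ne (hs.le.antisymm h2)

lemma reflTransGen_siEdgeAt_siLE {a : ℚ} {x y : petersonReps b (stabSet b lam)}
    (h : Relation.ReflTransGen (SiEdgeAt b lam a) x y) : SiLE b x y :=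
  Relation.ReflTransGen.mono (fun _ _ ⟨β, hβ, _⟩ => ⟨β, hβ⟩) _ _ h

end Comparison

/-! ### Lifting chains, and the proposition -/

/-- A sequence of relations can be lifted along a map `f`, starting from the last term. -/
lemma exists_lift_of_forall_step {X Y : Type*} (f : X → Y) {k : ℕ} (r : Fin k → X → X → Prop)
    (R : Fin k → Y → Y → Prop) (hf : Function.Surjective f)
    (hlift : ∀ u x ν, R u (f x) ν → ∃ y, f y = ν ∧ r u x y) (d : Fin (k + 1) → Y)
    (hd : ∀ u : Fin k, R u (d u.succ) (d u.castSucc)) :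
    ∃ e : Fin (k + 1) → X, (∀ u, f (e u) = d u) ∧ ∀ u : Fin k, r u (e u.succ) (e u.castSucc) := by
  induction k with
  | zero =>
    obtain ⟨x, hx⟩ := hf (d 0)
    exact ⟨fun _ => x, fun u => by rw [hx, Fin.fin_one_eq_zero u], fun u => u.elim0⟩
  | succ k ih =>
    -- Relations run from index u + 1 to u, so the tail is lifted first and the head is then reached
    -- from the chosen lift `e 0`.
    obtain ⟨e, he, he'⟩ := ih (fun u => r u.succ) (fun u => R u.succ) (fun u => hlift u.succ)
      (fun u => d u.succ) (fun u => hd u.succ)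
    obtain ⟨y, hy, hy'⟩ := hlift 0 (e 0) (d 0) (by rw [he]; exact hd 0)
    refine ⟨Fin.cons y e, fun u => ?_, fun u => ?_⟩
    · refine Fin.cases ?_ (fun u => ?_) u
      · simpa using hy
      · simpa using he u
    · refine Fin.cases ?_ (fun u => ?_) u
      · simpa using hy'
      · have := he' u
        rw [← Fin.succ_castSucc, Fin.cons_succ, Fin.cons_succ]
        exact this

end SiLS

end
theorem proposition3p1 {ι M N : Type*} [Fintype ι] [AddCommGroup M] [Module ℂ M]
    [AddCommGroup N] [Module ℂ N] (P : RootPairing ι ℂ M N) [P.IsRootSystem] [P.IsReduced]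
    [P.IsCrystallographic] [P.IsIrreducible] (b : P.Base) (lam : SiLS.LevelZeroWeight M)
    (hlam : SiLS.IsDominant b lam) :
    Set.MapsTo (SiLS.bar b lam) (SiLS.siLSPaths b lam) (SiLS.lsPaths b lam) ∧
      Set.SurjOn (SiLS.bar b lam) (SiLS.siLSPaths b lam) (SiLS.lsPaths b lam) := by
  constructor
  · intro η hη
    exact
      { brk_zero := hη.brk_zero
        brk_last := hη.brk_last
        brk_strictMono := hη.brk_strictMono
        decreasing := fun u => (hη.decreasing u).1.lLT hlam (hη.decreasing u).2
        directed := fun u => Relation.ReflTransGen.lift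
          (fun x : SiLS.petersonReps b (SiLS.stabSet b lam) =>
            (x : SiLS.AffineWeyl P) • SiLS.basePoint P lam)
          (fun _ _ h => SiLS.SiEdgeAt.lEdgeAt hlam h) _ _ (hη.directed u) }
  · rintro ⟨k, d, a⟩ hπ
    obtain ⟨e, he, he'⟩ := SiLS.exists_lift_of_forall_step
      (fun x : SiLS.petersonReps b (SiLS.stabSet b lam) =>
        (x : SiLS.AffineWeyl P) • SiLS.basePoint P lam)
      (fun u : Fin k => Relation.ReflTransGen (SiLS.SiEdgeAt b lam (a u.succ.castSucc)))
      (fun u => Relation.ReflTransGen (SiLS.LEdgeAt b lam (a u.succ.castSucc)))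
      (SiLS.exists_petersonRep hlam)
      (fun u x ν h => SiLS.exists_siEdgeAt_path hlam h rfl) d hπ.directed
    refine ⟨⟨k, e, a⟩, ⟨hπ.brk_zero, hπ.brk_last, hπ.brk_strictMono, fun u => ⟨?_, fun h => ?_⟩,
      he'⟩, ?_⟩
    · exact SiLS.reflTransGen_siEdgeAt_siLE (he' u)
    -- Consecutive lifts are distinct because their images are.
    · refine (hπ.decreasing u).2 ?_
      change d u.succ = d u.castSucc
      rw [← he, ← he]
      exact congrArg (fun x : SiLS.petersonReps b (SiLS.stabSet b lam) =>
        (x : SiLS.AffineWeyl P) • SiLS.basePoint P lam) h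
    · unfold SiLS.bar SiLS.PathData.map
      congr 1
      exact funext he
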